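/- Let $d_x, n \ge 1$ be integers, let $A \in \mathbb{R}^{d_x \times d_x}$ be stable, i.e. its spectral radius satisfies $\rho(A) < 1$, and let $x_0 = 0$ and $x_{i+1} = A x_i + \eta_i$ for $i \ge 0$, where $(\eta_i)_{i \ge 0}$ are i.i.d. random vectors in $\mathbb{R}^{d_x}$ that are zero-mean, isotropic ($\mathbb{E}[\eta_i \eta_i^\top] = I_{d_x}$) and $\sigma^2$-sub-Gaussian, i.e. $\mathbb{E}[\exp(t\, u^\top \eta_i)] \le \exp(\sigma^2 t^2/2)$ for all $t \in \mathbb{R}$ and all Euclidean unit vectors $u$. Let $X \in \mathbb{R}^{n \times d_x}$ be the matrix with rows $x_1^\top, \dots, x_n^\top$, and put $$\hat\Sigma = \frac1n X^\top X, \qquad \Gamma_i(A) = \sum_{k=0}^{i} A^k (A^k)^\top, \qquad \Gamma_\infty(A) = \sum_{k=0}^{\infty} A^k (A^k)^\top, \qquad \Sigma = \frac1n \sum_{i=0}^{n-1} \Gamma_i(A).$$ Write $\lambda_1(M) \ge \dots \ge \lambda_{d_x}(M) = \lambda_{\min}(M)$ for the eigenvalues of a symmetric matrix $M$, with multiplicity,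 and $\Vert M \Vert_2$ for its spectral norm. There are universal constants $c_1, c_2, c_3, c_4 > 0$ such that for every $\delta > 0$ the following hold. (a) If $n \ge \dfrac{c_1 \sigma^4 \Vert \Gamma_\infty(A) \Vert_2^3}{\lambda_{\min}(\Sigma)} \left( \log\frac1\delta + c_2 d_x \right)$, then with probability at least $1-\delta$, $$\forall i \in \{1, \dots, d_x\}, \qquad \tfrac12 \lambda_i(\Sigma) \le \lambda_i(\hat\Sigma) \le \tfrac32 \lambda_i(\Sigma).$$ (b) If $n \ge \dfrac{c_3 \sigma^4 \Vert \Gamma_\infty(A) \Vert_2^3}{\lambda_{\min}(\Gamma_\infty(A))} \left( \log\frac1\delta + c_4 d_x \right)$, then with probability at least $1-\delta$, $$\forall i \in \{1, \dots, d_x\}, \qquad \tfrac18 \lambda_i(\Gamma_\infty(A)) \le \lambda_i(\hat\Sigma) \le \tfrac32 \lambda_i(\Gamma_\infty(A)).$$ -/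

import Mathlib

open MeasureTheory ProbabilityTheory
open scoped NNReal Matrix

noncomputable section

namespace LDS

variable {d : ℕ}

/-- The eigenvalues of a real symmetric matrix counted with multiplicity and listed in
non-increasing order, `i = 0` being the largest one. -/
def eig {M : Matrix (Fin d) (Fin d) ℝ} (hM : M.IsHermitian) (i : Fin d) : ℝ :=
  hM.eigenvalues₀ (Fin.cast (Fintype.card_fin d).symm i)

/-- The smallest eigenvalue of a real symmetric matrix. -/
def eigMin {M : Matrix (Fin d) (Fin d) ℝ} (hM : M.IsHermitian) : ℝ :=
  ⨅ i, eig hM i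

/-- The spectral norm: the operator norm with respect to the Euclidean norm. -/
def opNorm (M : Matrix (Fin d) (Fin d) ℝ) : ℝ :=
  ‖Matrix.toEuclideanCLM (n := Fin d) (𝕜 := ℝ) M‖

/-- A square real matrix is stable when its (complex) spectral radius is less than one. -/
def IsStable (A : Matrix (Fin d) (Fin d) ℝ) : Prop :=
  spectralRadius ℂ (A.map Complex.ofReal) < 1

/-- The finite-time controllability Gramian `∑_{k=0}^{t} A^k (A^k)ᵀ`. -/
def gramian (A : Matrix (Fin d) (Fin d) ℝ) (t : ℕ) : Matrix (Fin d) (Fin d) ℝ :=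
  ∑ k ∈ Finset.range (t + 1), A ^ k * (A ^ k)ᵀ

/-- The infinite-time controllability Gramian `∑_{k=0}^{∞} A^k (A^k)ᵀ`; the series converges
when `A` is stable. -/
def gramianInf (A : Matrix (Fin d) (Fin d) ℝ) : Matrix (Fin d) (Fin d) ℝ :=
  ∑' k : ℕ, A ^ k * (A ^ k)ᵀ

/-- The averaged Gramian `Σ = (1/n) ∑_{i=0}^{n-1} Γ_i(A)`. -/
def avgCov (A : Matrix (Fin d) (Fin d) ℝ) (n : ℕ) : Matrix (Fin d) (Fin d) ℝ :=
  (n : ℝ)⁻¹ • ∑ i ∈ Finset.range n, gramian A i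

/-- The `n × d` data matrix with rows `x_1, …, x_n`. -/
def dataMatrix (x : ℕ → Fin d → ℝ) (n : ℕ) : Matrix (Fin n) (Fin d) ℝ :=
  Matrix.of fun i j => x (i + 1) j

/-- The empirical covariance matrix `(1/n) Xᵀ X`. -/
def empCov (x : ℕ → Fin d → ℝ) (n : ℕ) : Matrix (Fin d) (Fin d) ℝ :=
  (n : ℝ)⁻¹ • ((dataMatrix x n)ᵀ * dataMatrix x n)

theorem gramian_isHermitian (A : Matrix (Fin d) (Fin d) ℝ) (t : ℕ) :
    (gramian A t).IsHermitian := by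
  simp [gramian, Matrix.IsHermitian, Matrix.transpose_sum, Matrix.transpose_mul]

theorem gramianInf_isHermitian (A : Matrix (Fin d) (Fin d) ℝ) :
    (gramianInf A).IsHermitian := by
  simp [gramianInf, Matrix.IsHermitian, Matrix.transpose_tsum, Matrix.transpose_mul]

theorem avgCov_isHermitian (A : Matrix (Fin d) (Fin d) ℝ) (n : ℕ) :
    (avgCov A n).IsHermitian := by
  have h : ∀ i, (gramian A i)ᵀ = gramian A i := fun i => by
    simpa [Matrix.IsHermitian] using gramian_isHermitian A i
  simp [avgCov, Matrix.IsHermitian, Matrix.transpose_sum, h]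

theorem empCov_isHermitian (x : ℕ → Fin d → ℝ) (n : ℕ) :
    (empCov x n).IsHermitian := by
  simp [empCov, Matrix.IsHermitian, Matrix.transpose_mul]

/-- A random vector `ξ` is `σ²`-sub-Gaussian when every one-dimensional marginal `⟨u, ξ⟩` along
a Euclidean unit vector `u` is: `E exp (t ⟨u, ξ⟩) ≤ exp (σ² t² / 2)` for all real `t`. -/
def IsSubGaussianVec {Ω : Type*} [MeasurableSpace Ω] (ξ : Ω → Fin d → ℝ) (σ : ℝ≥0)
    (μ : Measure Ω) : Prop :=
  ∀ u : Fin d → ℝ, u ⬝ᵥ u = 1 → HasSubgaussianMGF (fun ω => u ⬝ᵥ ξ ω) (σ ^ 2) μ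

/-- A random vector `ξ` is isotropic when `E[ξ ξᵀ]` is the identity matrix. -/
def IsIsotropic {Ω : Type*} [MeasurableSpace Ω] (ξ : Ω → Fin d → ℝ) (μ : Measure Ω) : Prop :=
  ∀ i j : Fin d, ∫ ω, ξ ω i * ξ ω j ∂μ = (1 : Matrix (Fin d) (Fin d) ℝ) i j

end LDS

end

namespace LDS

/-! Fix a direction `u`, let `V = σ²` and `p = ‖Γ_∞‖`. The sum of `(u ⬝ᵥ x (s + 1))²` over `s < n`
has mean `S = n uᵀΣu`. It is a quadratic function of the noise, and its deviations are controlled by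
an exponential supermartingale in time. To `l` times the running centred sum one adds a value
function: the squares of the future noiseless evolution, with weights `l + w k`. Integrating out one
noise vector (`expMoment_step`) produces a cross term whose cost is a quadratic form in the current
state; the increase of `w` along the orbit absorbs it.

Such weights exist by stability. The Lyapunov equation makes the form of `Γ_∞` contract by `1 - 1/p`
along `Aᵀ`, so weights growing at rate `1 + 1/(2p)` remain summable against the orbit
(`hasOrbitBound`). The accumulated cost is of second order in `l`; for `|l|` of order `1/(V² p³
|u|²)` it is at most `|l| S / 16`. Markov's inequality for both signs of `l` bounds the probability
of a deviation larger than `S / 8` (`measure_path_deviation_le`). Since `S ≥ n λ_min(Σ) |u|²`, the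
exponent is of order `n λ_min(Σ) / (σ⁴ p³)`.

Whitening by `Σ` turns the relative error into a form to be bounded on the unit sphere, where a net
of at most `25^d` points suffices; this gives `Σ/2 ≤ Σ̂ ≤ 3Σ/2` in the Loewner order
(`exists_bad_event`). Courant–Fischer (`mul_eig_le_eig`) passes to ordered eigenvalues. Part (b)
follows from `Γ_∞/2 ≤ Σ ≤ Γ_∞`, whose left half holds once `n ≥ 2p`. -/

/-- The exponential moment `E exp f`, as an extended nonnegative real. -/
noncomputable def expMoment {α : Type*} [MeasurableSpace α] (ν : Measure α) (f : α → ℝ) :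
    ENNReal :=
  ∫⁻ z, ENNReal.ofReal (Real.exp (f z)) ∂ν

/-! ### Exponential moments of squares of sub-Gaussian variables -/

section ExpMoment

variable {α : Type*} [MeasurableSpace α] {ν : Measure α}

theorem expMoment_add_const (f : α → ℝ) (c : ℝ) :
    expMoment ν (fun z => f z + c) = expMoment ν f * ENNReal.ofReal (Real.exp c) := by
  unfold expMoment
  rw [← lintegral_mul_const' _ _ ENNReal.ofReal_ne_top]
  congr 1 with z
  rw [Real.exp_add, ENNReal.ofReal_mul (Real.exp_pos _).le]

theorem expMoment_sub_le_one_iff (f : α → ℝ) (c : ℝ) :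
    expMoment ν (fun z => f z - c) ≤ 1 ↔ expMoment ν f ≤ ENNReal.ofReal (Real.exp c) := by
  have h : expMoment ν f
      = expMoment ν (fun z => f z - c) * ENNReal.ofReal (Real.exp c) := by
    rw [← expMoment_add_const]; simp
  have hpos : ENNReal.ofReal (Real.exp c) ≠ 0 := by simp [Real.exp_pos]
  rw [h]
  constructor
  · intro h1; simpa using mul_le_mul_left h1 (ENNReal.ofReal (Real.exp c))
  · intro h1
    exact (ENNReal.mul_le_mul_iff_left hpos ENNReal.ofReal_ne_top).1 (by simpa using h1)

theorem expMoment_mono {f g : α → ℝ} (h : ∀ z, f z ≤ g z) : expMoment ν f ≤ expMoment ν g :=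
  lintegral_mono fun z => ENNReal.ofReal_le_ofReal (Real.exp_le_exp.2 (h z))

/-- Convexity of `exp` plays the role of Hölder's inequality, so no independence among the `φ i` is
needed. -/
theorem expMoment_convexComb_le {ι : Type*} (s : Finset ι) (p : ι → ℝ) (φ : ι → α → ℝ)
    (B : ENNReal) (hp : ∀ i ∈ s, 0 ≤ p i) (hp1 : ∑ i ∈ s, p i = 1)
    (hφ : ∀ i ∈ s, Measurable (φ i)) (hB : ∀ i ∈ s, expMoment ν (φ i) ≤ B) :
    expMoment ν (fun z => ∑ i ∈ s, p i * φ i z) ≤ B := by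
  calc expMoment ν (fun z => ∑ i ∈ s, p i * φ i z)
      ≤ ∫⁻ z, ∑ i ∈ s, ENNReal.ofReal (p i) * ENNReal.ofReal (Real.exp (φ i z)) ∂ν := by
        refine lintegral_mono fun z => ?_
        have h := convexOn_exp.map_sum_le (t := s) (w := p) (p := fun i => φ i z) hp hp1
          (fun i _ => Set.mem_univ _)
        simp only [smul_eq_mul] at h
        refine (ENNReal.ofReal_le_ofReal h).trans ?_
        rw [ENNReal.ofReal_sum_of_nonneg fun i hi => mul_nonneg (hp i hi) (Real.exp_pos _).le]
        exact Finset.sum_le_sum fun i hi => (ENNReal.ofReal_mul (hp i hi)).le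
    _ = ∑ i ∈ s, ENNReal.ofReal (p i) * expMoment ν (φ i) := by
        rw [lintegral_finsetSum' _ fun i hi => by
          have := hφ i hi
          exact Measurable.aemeasurable (by fun_prop)]
        refine Finset.sum_congr rfl fun i hi => ?_
        rw [lintegral_const_mul' _ _ ENNReal.ofReal_ne_top]; rfl
    _ ≤ ∑ i ∈ s, ENNReal.ofReal (p i) * B :=
        Finset.sum_le_sum fun i hi => mul_le_mul_right (hB i hi) _
    _ = B := by
        rw [← Finset.sum_mul, ← ENNReal.ofReal_sum_of_nonneg hp, hp1]; simp

theorem expMoment_gaussianReal_mul (t : ℝ) :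
    expMoment (gaussianReal 0 1) (fun g => t * g) = ENNReal.ofReal (Real.exp (t ^ 2 / 2)) := by
  unfold expMoment
  rw [← ofReal_integral_eq_lintegral_ofReal (integrable_exp_mul_gaussianReal t)
    (ae_of_all _ fun _ => (Real.exp_pos _).le)]
  have h := congrFun (mgf_id_gaussianReal (μ := 0) (v := 1)) t
  simp only [mgf, id_eq] at h
  rw [h]; simp

theorem expMoment_gaussianReal_sq_le {b : ℝ} (hb : 0 ≤ b) (hb' : b ≤ 1 / 4) :
    expMoment (gaussianReal 0 1) (fun g => b * g ^ 2) ≤ ENNReal.ofReal (Real.exp (2 * b)) := by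
  have hval : expMoment (gaussianReal 0 1) (fun g => b * g ^ 2)
      = ENNReal.ofReal ((√(2 * Real.pi))⁻¹ * √(Real.pi / (1 / 2 - b))) := by
    unfold expMoment
    rw [gaussianReal_of_var_ne_zero _ one_ne_zero,
      lintegral_withDensity_eq_lintegral_mul _ (measurable_gaussianPDF 0 1) (by fun_prop)]
    rw [← integral_gaussian, ← integral_const_mul, ofReal_integral_eq_lintegral_ofReal]
    · congr 1 with x
      simp only [Pi.mul_apply, gaussianPDF, gaussianPDFReal]
      rw [← ENNReal.ofReal_mul (by positivity)]
      congr 1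
      rw [mul_assoc, ← Real.exp_add]
      simp
      left; ring
    · exact (integrable_exp_neg_mul_sq (by linarith)).const_mul _
    · exact ae_of_all _ fun x => by positivity
  rw [hval]
  refine ENNReal.ofReal_le_ofReal ?_
  rw [← Real.sqrt_inv, ← Real.sqrt_mul (by positivity)]
  refine Real.sqrt_le_iff.2 ⟨(Real.exp_pos _).le, ?_⟩
  have h1 : (2 * Real.pi)⁻¹ * (Real.pi / (1 / 2 - b)) = (1 - 2 * b)⁻¹ := by
    have : 1 / 2 - b ≠ 0 := by linarith
    have : 1 - 2 * b ≠ 0 := by linarith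
    field_simp
  rw [h1, ← Real.exp_nat_mul]
  have h2 : 1 + 4 * b ≤ Real.exp (4 * b) := by linarith [Real.add_one_le_exp (4 * b)]
  -- `(1 + 4b)(1 - 2b) = 1 + 2b(1 - 4b)`, which is where `b ≤ 1/4` enters.
  calc (1 - 2 * b)⁻¹ ≤ 1 + 4 * b := by
        rw [inv_le_iff_one_le_mul₀ (by linarith)]; nlinarith
    _ ≤ _ := by convert h2 using 2; push_cast; ring

/-- Gaussian linearisation: `exp (s Y²)` is the average of `exp (√(2s) g Y)` over a standard normal
`g`. After Tonelli the sub-Gaussian bound applies for each fixed `g` and leaves a Gaussian integral.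
-/
theorem expMoment_sq_le [SFinite ν] {Y : α → ℝ} (hY : Measurable Y) {v : ℝ} (hv : 0 ≤ v)
    (hsub : ∀ t : ℝ, expMoment ν (fun z => t * Y z) ≤ ENNReal.ofReal (Real.exp (v * t ^ 2 / 2)))
    {s : ℝ} (hs : 0 ≤ s) (hsv : s * v ≤ 1 / 4) :
    expMoment ν (fun z => s * Y z ^ 2) ≤ ENNReal.ofReal (Real.exp (2 * (s * v))) := by
  have h2 : √(2 * s) ^ 2 = 2 * s := Real.sq_sqrt (by linarith)
  calc expMoment ν (fun z => s * Y z ^ 2)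
      = ∫⁻ z, expMoment (gaussianReal 0 1) (fun g => (√(2 * s) * Y z) * g) ∂ν := by
        unfold expMoment
        refine lintegral_congr fun z => ?_
        have := expMoment_gaussianReal_mul (√(2 * s) * Y z)
        unfold expMoment at this
        rw [this, mul_pow, h2]; congr 2; ring
    _ = ∫⁻ g, expMoment ν (fun z => (√(2 * s) * g) * Y z) ∂(gaussianReal 0 1) := by
        unfold expMoment
        rw [lintegral_lintegral_swap (by fun_prop)]
        refine lintegral_congr fun g => lintegral_congr fun z => ?_
        congr 2; ring
    _ ≤ expMoment (gaussianReal 0 1) (fun g => (s * v) * g ^ 2) := by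
        refine lintegral_mono fun g => (hsub _).trans (le_of_eq ?_)
        rw [mul_pow, h2]; congr 2; ring
    _ ≤ _ := expMoment_gaussianReal_sq_le (by positivity) hsv

theorem exp_le_one_add_add_sq_mul_exp_abs (x : ℝ) :
    Real.exp x ≤ 1 + x + x ^ 2 * Real.exp |x| := by
  have h := Complex.norm_exp_sub_sum_le_norm_mul_exp (x : ℂ) 2
  have e : Complex.exp x - ∑ m ∈ Finset.range 2, (x : ℂ) ^ m / m.factorial
      = ((Real.exp x - (1 + x) : ℝ) : ℂ) := by simp [Finset.sum_range_succ]
  rw [e, Complex.norm_real, Complex.norm_real, Real.norm_eq_abs, Real.norm_eq_abs, sq_abs] at h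
  linarith [le_abs_self (Real.exp x - (1 + x))]

theorem exp_mul_sub_le {y m s v : ℝ} (hm : 0 ≤ m) (hm1 : m ≤ 1) (hv : 1 / 2 ≤ v)
    (hs : |s| * v ≤ 1 / 16) :
    Real.exp (s * (y ^ 2 - m)) ≤ 1 + s * (y ^ 2 - m)
      + 512 * s ^ 2 * v ^ 2 * Real.exp (1 / 4) * Real.exp ((8 * v)⁻¹ * y ^ 2) := by
  set X := y ^ 2 - m with hX
  have hv0 : 0 < v := by linarith
  -- `r` is the largest admissible `|s|`. The square and the exponential in the Taylor remainder
  -- each cost one `exp (r |X|)`, and `2r = 1/(8v)` is the exponent at which `Y²` is known to be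
  -- integrable.
  set r := (16 * v)⁻¹ with hr
  have hrpos : 0 < r := by positivity
  have hsr : |s| ≤ r := by
    rw [hr, inv_eq_one_div, le_div_iff₀ (by positivity)]; linarith
  have hXabs : |X| ≤ y ^ 2 + 1 := by rw [abs_le]; constructor <;> nlinarith [sq_nonneg y]
  have hsq : (r * |X|) ^ 2 ≤ 2 * Real.exp (r * |X|) := by
    have := Real.quadratic_le_exp_of_nonneg (x := r * |X|) (by positivity)
    nlinarith [show 0 ≤ r * |X| by positivity]
  refine (exp_le_one_add_add_sq_mul_exp_abs _).trans ?_
  have hmain : (s * X) ^ 2 * Real.exp |s * X|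
      ≤ 512 * s ^ 2 * v ^ 2 * (Real.exp (1 / 4) * Real.exp ((8 * v)⁻¹ * y ^ 2)) := by
    have e1 : (s * X) ^ 2 = (256 * s ^ 2 * v ^ 2) * (r * |X|) ^ 2 := by
      rw [mul_pow r, sq_abs, hr]; field_simp; ring
    have e2 : Real.exp |s * X| ≤ Real.exp (r * |X|) := by
      rw [abs_mul]; gcongr
    have e3 : Real.exp (r * |X|) * Real.exp (r * |X|)
        ≤ Real.exp (1 / 4) * Real.exp ((8 * v)⁻¹ * y ^ 2) := by
      rw [← Real.exp_add, ← Real.exp_add, Real.exp_le_exp]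
      have h8 : (8 * v)⁻¹ = 2 * r := by rw [hr]; field_simp; norm_num
      have h9 : 2 * r ≤ 1 / 4 := by
        rw [← h8, inv_le_comm₀ (by positivity) (by norm_num)]; linarith
      rw [h8]; nlinarith
    rw [e1]
    calc 256 * s ^ 2 * v ^ 2 * (r * |X|) ^ 2 * Real.exp |s * X|
        ≤ 256 * s ^ 2 * v ^ 2 * (2 * Real.exp (r * |X|)) * Real.exp (r * |X|) := by gcongr
      _ = 512 * s ^ 2 * v ^ 2 * (Real.exp (r * |X|) * Real.exp (r * |X|)) := by ring
      _ ≤ _ := by gcongr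
  linarith

/-- Centring kills the linear term of the pointwise expansion, so the bound is quadratic in `s`. The
remainder contributes `512 s² v² exp (1/4) exp (1/4)`, and `exp (1/2) ≤ 2`. -/
theorem expMoment_sq_sub_le [IsProbabilityMeasure ν] {Y : α → ℝ} (hY : Measurable Y) {v : ℝ}
    (hv : 1 / 2 ≤ v)
    (hsub : ∀ t : ℝ, expMoment ν (fun z => t * Y z) ≤ ENNReal.ofReal (Real.exp (v * t ^ 2 / 2)))
    {m : ℝ} (hm1 : m ≤ 1) (hint : Integrable (fun z => Y z ^ 2) ν)
    (hm : ∫ z, Y z ^ 2 ∂ν = m) {s : ℝ} (hs : |s| * v ≤ 1 / 16) :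
    expMoment ν (fun z => s * (Y z ^ 2 - m))
      ≤ ENNReal.ofReal (Real.exp (1024 * s ^ 2 * v ^ 2)) := by
  have hv0 : 0 < v := by linarith
  have hm0 : 0 ≤ m := hm ▸ integral_nonneg fun z => sq_nonneg _
  have hE := expMoment_sq_le hY hv0.le hsub (s := (8 * v)⁻¹) (by positivity)
    (by field_simp; norm_num)
  have hmeas : Measurable fun z => Real.exp ((8 * v)⁻¹ * Y z ^ 2) := by fun_prop
  have hI : Integrable (fun z => Real.exp ((8 * v)⁻¹ * Y z ^ 2)) ν := by
    refine (lintegral_ofReal_ne_top_iff_integrable hmeas.aestronglyMeasurable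
      (ae_of_all _ fun _ => (Real.exp_pos _).le)).1 (ne_top_of_le_ne_top ENNReal.ofReal_ne_top hE)
  have hEr : ∫ z, Real.exp ((8 * v)⁻¹ * Y z ^ 2) ∂ν ≤ Real.exp (1 / 4) := by
    have h := hE
    unfold expMoment at h
    rw [← ofReal_integral_eq_lintegral_ofReal hI (ae_of_all _ fun _ => (Real.exp_pos _).le),
      ENNReal.ofReal_le_ofReal_iff (Real.exp_pos _).le] at h
    refine h.trans (le_of_eq ?_)
    congr 1; field_simp; norm_num
  set C := 512 * s ^ 2 * v ^ 2 * Real.exp (1 / 4) with hC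
  have hC0 : 0 ≤ C := by positivity
  have hpt := fun z => exp_mul_sub_le (y := Y z) hm0 hm1 hv hs
  set h : α → ℝ := fun z => 1 + s * (Y z ^ 2 - m) + C * Real.exp ((8 * v)⁻¹ * Y z ^ 2) with hh
  have hi1 : Integrable (fun z => s * (Y z ^ 2 - m)) ν :=
    (hint.sub (integrable_const _)).const_mul s
  have hi2 : Integrable (fun z => 1 + s * (Y z ^ 2 - m)) ν := (integrable_const _).add hi1
  have hi3 : Integrable (fun z => C * Real.exp ((8 * v)⁻¹ * Y z ^ 2)) ν := hI.const_mul C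
  calc expMoment ν (fun z => s * (Y z ^ 2 - m)) ≤ ∫⁻ z, ENNReal.ofReal (h z) ∂ν :=
        lintegral_mono fun z => ENNReal.ofReal_le_ofReal (hpt z)
    _ = ENNReal.ofReal (∫ z, h z ∂ν) :=
        (ofReal_integral_eq_lintegral_ofReal (hi2.add hi3)
          (ae_of_all _ fun z => (Real.exp_pos _).le.trans (hpt z))).symm
    _ ≤ _ := by
        refine ENNReal.ofReal_le_ofReal ?_
        rw [hh, integral_add hi2 hi3, integral_add (integrable_const _) hi1,
          integral_const_mul, integral_const_mul, integral_sub hint (integrable_const _), hm]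
        simp only [integral_const, probReal_univ, one_smul, sub_self, mul_zero, add_zero]
        have h1 : C * ∫ z, Real.exp ((8 * v)⁻¹ * Y z ^ 2) ∂ν ≤ 1024 * s ^ 2 * v ^ 2 := by
          calc _ ≤ C * Real.exp (1 / 4) := by gcongr
            _ = 512 * s ^ 2 * v ^ 2 * Real.exp (1 / 2) := by
                rw [hC, mul_assoc, ← Real.exp_add]; norm_num
            _ ≤ 512 * s ^ 2 * v ^ 2 * 2 := by
                gcongr
                have := Real.exp_one_lt_d9
                have h2 : Real.exp (1 / 2) * Real.exp (1 / 2) = Real.exp 1 := by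
                  rw [← Real.exp_add]; norm_num
                nlinarith [Real.exp_pos (1 / 2 : ℝ)]
            _ = _ := by ring
        linarith [Real.add_one_le_exp (1024 * s ^ 2 * v ^ 2)]

end ExpMoment

/-! ### Isotropic sub-Gaussian vectors and the one-step estimate -/

/-- A probability law on `ℝ^d` that is isotropic and sub-Gaussian with variance proxy `v`. -/
structure IsIsotropicSubGaussian {d : ℕ} (ν : Measure (Fin d → ℝ)) (v : ℝ) : Prop where
  half_le : 1 / 2 ≤ v
  expMoment_le : ∀ y : Fin d → ℝ,
    expMoment ν (fun z => y ⬝ᵥ z) ≤ ENNReal.ofReal (Real.exp (v * (y ⬝ᵥ y) / 2))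
  integrable_sq : ∀ y : Fin d → ℝ, Integrable (fun z => (y ⬝ᵥ z) ^ 2) ν
  integral_sq : ∀ y : Fin d → ℝ, ∫ z, (y ⬝ᵥ z) ^ 2 ∂ν = y ⬝ᵥ y

theorem dotProduct_self_nonneg' {d : ℕ} (y : Fin d → ℝ) : 0 ≤ y ⬝ᵥ y :=
  Finset.sum_nonneg fun i _ => mul_self_nonneg (y i)

theorem measurable_dotProduct {d : ℕ} (y : Fin d → ℝ) : Measurable fun z => y ⬝ᵥ z := by
  unfold dotProduct; fun_prop

/-- Weighted Cauchy–Schwarz in each coordinate. It bounds the cost of the cross term by the same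
weighted squares of the state that the value function contains. -/
theorem dotProduct_sum_smul_self_le {d : ℕ} {ι : Type*} (s : Finset ι) (w c : ι → ℝ)
    (a : ι → Fin d → ℝ) (hw : ∀ k ∈ s, 0 ≤ w k) :
    (∑ k ∈ s, (w k * c k) • a k) ⬝ᵥ (∑ k ∈ s, (w k * c k) • a k)
      ≤ (∑ k ∈ s, w k * (a k ⬝ᵥ a k)) * ∑ k ∈ s, w k * c k ^ 2 := by
  calc (∑ k ∈ s, (w k * c k) • a k) ⬝ᵥ (∑ k ∈ s, (w k * c k) • a k)
      = ∑ j, (∑ k ∈ s, w k * c k * a k j) ^ 2 := by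
        simp only [dotProduct, Finset.sum_apply, Pi.smul_apply, smul_eq_mul, sq]
    _ ≤ ∑ j, (∑ k ∈ s, w k * a k j ^ 2) * ∑ k ∈ s, w k * c k ^ 2 := by
        refine Finset.sum_le_sum fun j _ => ?_
        refine Finset.sum_sq_le_sum_mul_sum_of_sq_le_mul s
          (fun k hk => mul_nonneg (hw k hk) (sq_nonneg _))
          (fun k hk => mul_nonneg (hw k hk) (sq_nonneg _)) fun k hk => (by ring : _ = _).le
    _ = _ := by
        rw [← Finset.sum_mul, Finset.sum_comm]
        simp only [dotProduct, Finset.mul_sum, sq]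

section Law

variable {d : ℕ} {ν : Measure (Fin d → ℝ)} {v : ℝ}

theorem IsIsotropicSubGaussian.expMoment_mul_le (hν : IsIsotropicSubGaussian ν v)
    {u : Fin d → ℝ} (hu : u ⬝ᵥ u ≤ 1) (t : ℝ) :
    expMoment ν (fun z => t * (u ⬝ᵥ z)) ≤ ENNReal.ofReal (Real.exp (v * t ^ 2 / 2)) := by
  have h := hν.expMoment_le (t • u)
  simp only [smul_dotProduct, dotProduct_smul, smul_eq_mul] at h
  refine h.trans (ENNReal.ofReal_le_ofReal (Real.exp_le_exp.2 ?_))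
  have hv := hν.half_le
  have : t * (t * (u ⬝ᵥ u)) ≤ t ^ 2 := by nlinarith [sq_nonneg t]
  have h2 : v * (t * (t * (u ⬝ᵥ u))) ≤ v * t ^ 2 := mul_le_mul_of_nonneg_left this (by linarith)
  linarith

/-- The unit vector in the direction of `a` (zero when `a = 0`). -/
noncomputable def direction (a : Fin d → ℝ) : Fin d → ℝ := (√(a ⬝ᵥ a))⁻¹ • a

theorem mul_direction_dotProduct_sq (a z : Fin d → ℝ) :
    (a ⬝ᵥ a) * (direction a ⬝ᵥ z) ^ 2 = (a ⬝ᵥ z) ^ 2 := by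
  rcases eq_or_ne a 0 with rfl | ha
  · simp
  · have h0 : a ⬝ᵥ a ≠ 0 := by simpa using ha
    rw [direction, smul_dotProduct, smul_eq_mul, mul_pow, inv_pow,
      Real.sq_sqrt (dotProduct_self_nonneg' a), mul_inv_cancel_left₀ h0]

theorem direction_dotProduct_self_le (a : Fin d → ℝ) : direction a ⬝ᵥ direction a ≤ 1 := by
  rw [direction, smul_dotProduct, dotProduct_smul, smul_eq_mul, smul_eq_mul, ← mul_assoc,
    ← sq, inv_pow, Real.sq_sqrt (dotProduct_self_nonneg' a)]
  exact inv_mul_le_one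

theorem mul_direction_dotProduct_self (a : Fin d → ℝ) :
    (a ⬝ᵥ a) * (direction a ⬝ᵥ direction a) = a ⬝ᵥ a := by
  rcases eq_or_ne a 0 with rfl | ha
  · simp
  · have h0 : a ⬝ᵥ a ≠ 0 := by simpa using ha
    rw [direction, smul_dotProduct, dotProduct_smul, smul_eq_mul, smul_eq_mul, ← mul_assoc (√_)⁻¹,
      ← sq, inv_pow, Real.sq_sqrt (dotProduct_self_nonneg' a), mul_inv_cancel_left₀ h0]

variable {ι : Type*} (s : Finset ι) (c : ι → ℝ) (a : ι → Fin d → ℝ)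

/-- Normalising each `a k` exhibits the form as a convex combination, with weights `c k |a k|² / T`,
of squares of one-dimensional marginals. Only the trace `T` enters, not the number of terms; `T = 0`
is degenerate and treated apart. -/
theorem IsIsotropicSubGaussian.expMoment_quadratic_le [IsProbabilityMeasure ν]
    (hν : IsIsotropicSubGaussian ν v) (hc : ∀ k ∈ s, 0 ≤ c k) {r : ℝ} (hr : 0 ≤ r)
    (hrT : r * v * ∑ k ∈ s, c k * (a k ⬝ᵥ a k) ≤ 1 / 4) :
    expMoment ν (fun z => r * ∑ k ∈ s, c k * (a k ⬝ᵥ z) ^ 2)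
      ≤ ENNReal.ofReal (Real.exp (2 * (r * v * ∑ k ∈ s, c k * (a k ⬝ᵥ a k)))) := by
  set T := ∑ k ∈ s, c k * (a k ⬝ᵥ a k) with hT
  have hnn : ∀ k ∈ s, 0 ≤ c k * (a k ⬝ᵥ a k) := fun k hk =>
    mul_nonneg (hc k hk) (dotProduct_self_nonneg' _)
  have hT0 : 0 ≤ T := Finset.sum_nonneg hnn
  have hv : 0 ≤ v := by linarith [hν.half_le]
  have hrw : ∀ k z, c k * (a k ⬝ᵥ z) ^ 2
      = c k * (a k ⬝ᵥ a k) * (direction (a k) ⬝ᵥ z) ^ 2 := fun k z => by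
    rw [mul_assoc, mul_direction_dotProduct_sq]
  rcases hT0.eq_or_lt with h0 | hpos
  · have hz : ∀ k ∈ s, c k * (a k ⬝ᵥ a k) = 0 := (Finset.sum_eq_zero_iff_of_nonneg hnn).1 h0.symm
    have : ∀ z, ∑ k ∈ s, c k * (a k ⬝ᵥ z) ^ 2 = 0 := fun z =>
      Finset.sum_eq_zero fun k hk => by rw [hrw, hz k hk, zero_mul]
    simp [this, ← h0, expMoment]
  · have hconv := expMoment_convexComb_le (ν := ν) s (fun k => c k * (a k ⬝ᵥ a k) / T)
      (fun k z => r * T * (direction (a k) ⬝ᵥ z) ^ 2)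
      (ENNReal.ofReal (Real.exp (2 * (r * v * T))))
      (fun k hk => div_nonneg (hnn k hk) hT0) (by rw [← Finset.sum_div, ← hT, div_self hpos.ne'])
      (fun k _ => ((measurable_dotProduct _).pow_const 2).const_mul _)
      (fun k _ => by
        have := expMoment_sq_le (ν := ν) (measurable_dotProduct (direction (a k))) hv
          (hν.expMoment_mul_le (direction_dotProduct_self_le (a k))) (s := r * T) (by positivity)
          (by linarith [mul_right_comm r T v])
        rwa [mul_right_comm r T v] at this)
    convert hconv using 3 with z
    rw [Finset.mul_sum]
    refine Finset.sum_congr rfl fun k _ => ?_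
    rw [hrw]; field_simp

theorem IsIsotropicSubGaussian.expMoment_centered_le [IsProbabilityMeasure ν]
    (hν : IsIsotropicSubGaussian ν v) {r : ℝ}
    (hrT : |r| * v * ∑ k ∈ s, a k ⬝ᵥ a k ≤ 1 / 16) :
    expMoment ν (fun z => r * (∑ k ∈ s, (a k ⬝ᵥ z) ^ 2 - ∑ k ∈ s, a k ⬝ᵥ a k))
      ≤ ENNReal.ofReal (Real.exp (1024 * r ^ 2 * v ^ 2 * (∑ k ∈ s, a k ⬝ᵥ a k) ^ 2)) := by
  set T := ∑ k ∈ s, a k ⬝ᵥ a k with hT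
  have hnn : ∀ k ∈ s, 0 ≤ a k ⬝ᵥ a k := fun k _ => dotProduct_self_nonneg' _
  have hT0 : 0 ≤ T := Finset.sum_nonneg hnn
  rcases hT0.eq_or_lt with h0 | hpos
  · have hz : ∀ k ∈ s, a k ⬝ᵥ a k = 0 := (Finset.sum_eq_zero_iff_of_nonneg hnn).1 h0.symm
    have : ∀ z, ∑ k ∈ s, (a k ⬝ᵥ z) ^ 2 = 0 := fun z =>
      Finset.sum_eq_zero fun k hk => by rw [← mul_direction_dotProduct_sq, hz k hk, zero_mul]
    simp [this, ← h0, expMoment]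
  · have hconv := expMoment_convexComb_le (ν := ν) s (fun k => (a k ⬝ᵥ a k) / T)
      (fun k z => r * T * ((direction (a k) ⬝ᵥ z) ^ 2 - direction (a k) ⬝ᵥ direction (a k)))
      (ENNReal.ofReal (Real.exp (1024 * r ^ 2 * v ^ 2 * T ^ 2)))
      (fun k hk => div_nonneg (hnn k hk) hT0) (by rw [← Finset.sum_div, ← hT, div_self hpos.ne'])
      (fun k _ => (((measurable_dotProduct _).pow_const 2).sub_const _).const_mul _)
      (fun k _ => by
        have := expMoment_sq_sub_le (ν := ν) (measurable_dotProduct (direction (a k)))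
          hν.half_le (hν.expMoment_mul_le (direction_dotProduct_self_le (a k)))
          (direction_dotProduct_self_le (a k)) (hν.integrable_sq _) (hν.integral_sq _)
          (s := r * T) (by rw [abs_mul, abs_of_nonneg hT0]; linarith [mul_right_comm |r| T v])
        convert this using 3; ring)
    convert hconv using 3 with z
    rw [hT, ← Finset.sum_sub_distrib, Finset.mul_sum]
    refine Finset.sum_congr rfl fun k _ => ?_
    rw [← mul_direction_dotProduct_sq]
    nth_rewrite 2 [← mul_direction_dotProduct_self]
    rw [← hT]; field_simp

/-- One step of the exponential supermartingale: completing the square in a weighted sum of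
squares, at the price of increased weights. -/
theorem IsIsotropicSubGaussian.expMoment_step [IsProbabilityMeasure ν]
    (hν : IsIsotropicSubGaussian ν v) (w w' : ι → ℝ) (l : ℝ) (h : Fin d → ℝ)
    (hw0 : ∀ k ∈ s, 0 ≤ w k) {T K : ℝ} (hT : T = ∑ k ∈ s, a k ⬝ᵥ a k)
    (hK : K = ∑ k ∈ s, w k * (a k ⬝ᵥ a k)) (hlT : 4 * |l| * v * T ≤ 1 / 16)
    (hvK : 4 * v * K ≤ 1 / 4)
    (hw : ∀ k ∈ s, w k + 8 * v * l ^ 2 * T + 8 * v * K * w k ≤ w' k) :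
    expMoment ν (fun z => ∑ k ∈ s, (l + w k) * (a k ⬝ᵥ (h + z)) ^ 2 - l * T)
      ≤ ENNReal.ofReal (Real.exp (∑ k ∈ s, (l + w' k) * (a k ⬝ᵥ h) ^ 2
          + (4096 * l ^ 2 * v ^ 2 * T ^ 2 + 2 * v * K))) := by
  have hv : 0 ≤ v := by linarith [hν.half_le]
  -- The term linear in the noise is `2 (y ⬝ᵥ z)`. The `l` part is kept separate because `l` may be
  -- negative, while Cauchy–Schwarz needs nonnegative weights.
  set y₁ : Fin d → ℝ := ∑ k ∈ s, (1 * (a k ⬝ᵥ h)) • a k with hy₁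
  set y₂ : Fin d → ℝ := ∑ k ∈ s, (w k * (a k ⬝ᵥ h)) • a k with hy₂
  set y := l • y₁ + y₂ with hy
  have b₁ := dotProduct_sum_smul_self_le s (fun _ => 1) (fun k => a k ⬝ᵥ h) a (by simp)
  have b₂ := dotProduct_sum_smul_self_le s w (fun k => a k ⬝ᵥ h) a hw0
  simp only [one_mul] at b₁
  simp only [one_mul] at hy₁
  rw [← hy₁, ← hT] at b₁
  rw [← hy₂, ← hK] at b₂
  have byy : y ⬝ᵥ y ≤ 2 * l ^ 2 * (y₁ ⬝ᵥ y₁) + 2 * (y₂ ⬝ᵥ y₂) := by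
    have h1 := dotProduct_self_nonneg' (l • y₁ - y₂)
    simp only [sub_dotProduct, dotProduct_sub, smul_dotProduct, dotProduct_smul, smul_eq_mul] at h1
    rw [hy]
    simp only [add_dotProduct, dotProduct_add, smul_dotProduct, dotProduct_smul, smul_eq_mul]
    nlinarith [h1]
  have hyz : ∀ z, y ⬝ᵥ z = ∑ k ∈ s, (l + w k) * (a k ⬝ᵥ h) * (a k ⬝ᵥ z) := fun z => by
    simp only [hy, hy₁, hy₂, add_dotProduct, smul_dotProduct, sum_dotProduct, smul_eq_mul,
      Finset.mul_sum, ← Finset.sum_add_distrib]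
    exact Finset.sum_congr rfl fun k _ => by ring
  -- The increments `w' - w` pay exactly for the exponential moment of the cross term.
  have hdrift : ∑ k ∈ s, (l + w k) * (a k ⬝ᵥ h) ^ 2 + 4 * v * (y ⬝ᵥ y)
      ≤ ∑ k ∈ s, (l + w' k) * (a k ⬝ᵥ h) ^ 2 := by
    have h1 : ∑ k ∈ s, (l + (w k + 8 * v * l ^ 2 * T + 8 * v * K * w k)) * (a k ⬝ᵥ h) ^ 2
        ≤ ∑ k ∈ s, (l + w' k) * (a k ⬝ᵥ h) ^ 2 :=
      Finset.sum_le_sum fun k hk => by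
        have := hw k hk
        gcongr
    have h2 : ∑ k ∈ s, (l + (w k + 8 * v * l ^ 2 * T + 8 * v * K * w k)) * (a k ⬝ᵥ h) ^ 2
        = ∑ k ∈ s, (l + w k) * (a k ⬝ᵥ h) ^ 2
          + 8 * v * l ^ 2 * (T * ∑ k ∈ s, (a k ⬝ᵥ h) ^ 2)
          + 8 * v * (K * ∑ k ∈ s, w k * (a k ⬝ᵥ h) ^ 2) := by
      simp only [Finset.mul_sum, ← Finset.sum_add_distrib]
      exact Finset.sum_congr rfl fun k _ => by ring
    have h3 : 4 * v * (y ⬝ᵥ y) ≤ 4 * v * (2 * l ^ 2 * (y₁ ⬝ᵥ y₁) + 2 * (y₂ ⬝ᵥ y₂)) := by gcongr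
    have h4 : 8 * v * l ^ 2 * (y₁ ⬝ᵥ y₁) ≤ 8 * v * l ^ 2 * (T * ∑ k ∈ s, (a k ⬝ᵥ h) ^ 2) := by
      gcongr
    have h5 : 8 * v * (y₂ ⬝ᵥ y₂) ≤ 8 * v * (K * ∑ k ∈ s, w k * (a k ⬝ᵥ h) ^ 2) := by gcongr
    linarith
  rw [← expMoment_sub_le_one_iff]
  -- The cross, centred and weighted parts, each multiplied by the inverse of its convex weight
  -- `1/2`, `1/4`, `1/4` and shifted so that its exponential moment is at most `1`.
  let φ : Fin 3 → (Fin d → ℝ) → ℝ := ![fun z => (4 : ℝ) • y ⬝ᵥ z - 8 * v * (y ⬝ᵥ y),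
    fun z => 4 * l * (∑ k ∈ s, (a k ⬝ᵥ z) ^ 2 - T) - 1024 * (4 * l) ^ 2 * v ^ 2 * T ^ 2,
    fun z => 4 * (∑ k ∈ s, w k * (a k ⬝ᵥ z) ^ 2) - 2 * (4 * v * K)]
  have hmeas : ∀ k, Measurable fun z => (a k ⬝ᵥ z) ^ 2 := fun k =>
    (measurable_dotProduct _).pow_const 2
  refine (expMoment_mono fun z => ?_).trans (expMoment_convexComb_le (ν := ν) Finset.univ
    (![1 / 2, 1 / 4, 1 / 4] : Fin 3 → ℝ) φ 1 ?_ ?_ ?_ ?_)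
  · simp only [φ, Fin.sum_univ_three, Matrix.cons_val_zero, Matrix.cons_val_one, Matrix.cons_val,
      smul_dotProduct, smul_eq_mul]
    rw [hyz z]
    have e1 : ∑ k ∈ s, (l + w k) * (a k ⬝ᵥ (h + z)) ^ 2
        = ∑ k ∈ s, (l + w k) * (a k ⬝ᵥ h) ^ 2
          + 2 * ∑ k ∈ s, (l + w k) * (a k ⬝ᵥ h) * (a k ⬝ᵥ z)
          + l * ∑ k ∈ s, (a k ⬝ᵥ z) ^ 2 + ∑ k ∈ s, w k * (a k ⬝ᵥ z) ^ 2 := by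
      simp only [Finset.mul_sum, ← Finset.sum_add_distrib, dotProduct_add]
      exact Finset.sum_congr rfl fun k _ => by ring
    rw [e1]
    linarith
  · intro i _; fin_cases i <;> norm_num
  · simp [Fin.sum_univ_three]; norm_num
  · intro i _
    fin_cases i
    · exact (measurable_dotProduct _).sub_const _
    · exact (((Finset.measurable_sum s fun k _ => hmeas k).sub_const _).const_mul _).sub_const _
    · exact ((Finset.measurable_sum s fun k _ => (hmeas k).const_mul _).const_mul _).sub_const _
  · intro i _
    fin_cases i
    · refine (expMoment_sub_le_one_iff _ _).2 ((hν.expMoment_le _).trans (le_of_eq ?_))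
      simp only [smul_dotProduct, dotProduct_smul, smul_eq_mul]
      congr 2; ring
    · refine (expMoment_sub_le_one_iff _ _).2 ?_
      rw [hT]
      refine hν.expMoment_centered_le s a ?_
      rw [← hT, abs_mul]; simpa using hlT
    · refine (expMoment_sub_le_one_iff _ _).2 ?_
      rw [hK]
      refine hν.expMoment_quadratic_le s w a hw0 (by norm_num) ?_
      rw [← hK]; exact hvK

end Law

/-! ### Geometric weights along the orbit of the transpose -/

section Weights

variable {d : ℕ}

/-- Quantitative stability: the orbits of `Aᵀ` are square summable with constant `p`, and still
so, with constant `2 p²`, under the weights `(1 + 1 / (2p))^k`. -/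
structure HasOrbitBound (A : Matrix (Fin d) (Fin d) ℝ) (p : ℝ) : Prop where
  one_le : 1 ≤ p
  sum_le : ∀ (u : Fin d → ℝ) (m : ℕ),
    ∑ k ∈ Finset.range m, ((Aᵀ ^ k) *ᵥ u) ⬝ᵥ ((Aᵀ ^ k) *ᵥ u) ≤ p * (u ⬝ᵥ u)
  weighted_sum_le : ∀ (u : Fin d → ℝ) (m : ℕ),
    ∑ k ∈ Finset.range m, (1 + 1 / (2 * p)) ^ k * (((Aᵀ ^ k) *ᵥ u) ⬝ᵥ ((Aᵀ ^ k) *ᵥ u))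
      ≤ 2 * p ^ 2 * (u ⬝ᵥ u)

/-- Squared length of the `k`-th point of the orbit of `u` under `Aᵀ`. -/
def orbitSq (A : Matrix (Fin d) (Fin d) ℝ) (u : Fin d → ℝ) (k : ℕ) : ℝ :=
  ((Aᵀ ^ k) *ᵥ u) ⬝ᵥ ((Aᵀ ^ k) *ᵥ u)

theorem orbitSq_nonneg (A : Matrix (Fin d) (Fin d) ℝ) (u : Fin d → ℝ) (k : ℕ) :
    0 ≤ orbitSq A u k := dotProduct_self_nonneg' _

theorem orbitSq_add (A : Matrix (Fin d) (Fin d) ℝ) (u : Fin d → ℝ) (j i : ℕ) :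
    orbitSq A ((Aᵀ ^ i) *ᵥ u) j = orbitSq A u (i + j) := by
  unfold orbitSq
  rw [Matrix.mulVec_mulVec, ← pow_add, add_comm]

/-- The weights `b (1 + θ + ⋯ + θ^{k-1})`. -/
def geomWeight (b θ : ℝ) (k : ℕ) : ℝ := b * ∑ j ∈ Finset.range k, θ ^ j

theorem geomWeight_zero (b θ : ℝ) : geomWeight b θ 0 = 0 := by simp [geomWeight]

theorem geomWeight_succ (b θ : ℝ) (k : ℕ) :
    geomWeight b θ (k + 1) = θ * geomWeight b θ k + b := by
  unfold geomWeight; rw [geom_sum_succ]; ring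

theorem geomWeight_nonneg {b θ : ℝ} (hb : 0 ≤ b) (hθ : 0 ≤ θ) (k : ℕ) :
    0 ≤ geomWeight b θ k :=
  mul_nonneg hb (Finset.sum_nonneg fun _ _ => pow_nonneg hθ _)

/-- Expand the weight and reindex by `k = i + j`: the inner sum becomes the weighted sum of the
orbit restarted at its `i`-th point, to which `weighted_sum_le` applies. -/
theorem HasOrbitBound.sum_geomWeight_le {A : Matrix (Fin d) (Fin d) ℝ} {p : ℝ}
    (hA : HasOrbitBound A p) (u : Fin d → ℝ) {b : ℝ} (hb : 0 ≤ b) (m : ℕ) :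
    ∑ k ∈ Finset.range m, geomWeight b (1 + 1 / (2 * p)) k * orbitSq A u k
      ≤ 2 * p ^ 2 * b * ∑ k ∈ Finset.range m, orbitSq A u k := by
  have hp := hA.one_le
  set θ := 1 + 1 / (2 * p) with hθ
  have hθ0 : 0 ≤ θ := by positivity
  have hnn : ∀ j k, 0 ≤ θ ^ j * orbitSq A u k := fun j k =>
    mul_nonneg (pow_nonneg hθ0 _) (orbitSq_nonneg A u k)
  have key : ∑ k ∈ Finset.range m, ∑ j ∈ Finset.range k, θ ^ j * orbitSq A u k
      ≤ 2 * p ^ 2 * ∑ k ∈ Finset.range m, orbitSq A u k := by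
    calc ∑ k ∈ Finset.range m, ∑ j ∈ Finset.range k, θ ^ j * orbitSq A u k
        ≤ ∑ k ∈ Finset.range m, ∑ j ∈ Finset.range (k + 1), θ ^ j * orbitSq A u (k - j + j) := by
          refine Finset.sum_le_sum fun k _ => ?_
          rw [Finset.sum_range_succ]
          have : ∑ j ∈ Finset.range k, θ ^ j * orbitSq A u k
              = ∑ j ∈ Finset.range k, θ ^ j * orbitSq A u (k - j + j) :=
            Finset.sum_congr rfl fun j hj => by
              rw [Nat.sub_add_cancel (Finset.mem_range.1 hj).le]
          rw [this]
          exact le_add_of_nonneg_right (hnn _ _)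
      _ = ∑ j ∈ Finset.range m, ∑ i ∈ Finset.range (m - j), θ ^ j * orbitSq A u (i + j) :=
          Finset.sum_range_diag_flip m fun j i => θ ^ j * orbitSq A u (i + j)
      _ ≤ ∑ j ∈ Finset.range m, ∑ i ∈ Finset.range m, θ ^ j * orbitSq A u (i + j) :=
          Finset.sum_le_sum fun j _ => Finset.sum_le_sum_of_subset_of_nonneg
            (Finset.range_mono (Nat.sub_le _ _)) fun i _ _ => hnn _ _
      _ = ∑ i ∈ Finset.range m, ∑ j ∈ Finset.range m,
            θ ^ j * orbitSq A ((Aᵀ ^ i) *ᵥ u) j := by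
          rw [Finset.sum_comm]; simp only [orbitSq_add]
      _ ≤ ∑ i ∈ Finset.range m, 2 * p ^ 2 * orbitSq A u i :=
          Finset.sum_le_sum fun i _ => hA.weighted_sum_le _ m
      _ = _ := by rw [Finset.mul_sum]
  calc _ = b * ∑ k ∈ Finset.range m, ∑ j ∈ Finset.range k, θ ^ j * orbitSq A u k := by
        simp only [geomWeight, Finset.mul_sum, Finset.sum_mul, mul_assoc]
    _ ≤ b * (2 * p ^ 2 * ∑ k ∈ Finset.range m, orbitSq A u k) := by gcongr
    _ = _ := by ring

end Weights

/-! ### The exponential supermartingale along the trajectory -/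

section Trajectory

variable {Ω : Type*} {d : ℕ} {A : Matrix (Fin d) (Fin d) ℝ} {η x : ℕ → Ω → Fin d → ℝ}

/-- Conditioning on the past by Tonelli: the joint law is a product, so a bound with the past `u`
frozen can be integrated. -/
theorem expMoment_le_of_indepFun [MeasurableSpace Ω] {μ : Measure Ω} [IsProbabilityMeasure μ]
    {β : Type*} [MeasurableSpace β] {U : Ω → β}
    {ξ : Ω → Fin d → ℝ} (hU : Measurable U) (hξ : Measurable ξ) (hind : IndepFun U ξ μ)
    {Ψ : β × (Fin d → ℝ) → ℝ} (hΨ : Measurable Ψ) {Φ : β → ℝ} (hΦ : Measurable Φ) (C : ENNReal)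
    (h : ∀ u, expMoment (μ.map ξ) (fun z => Ψ (u, z)) ≤ ENNReal.ofReal (Real.exp (Φ u)) * C) :
    expMoment μ (fun ω => Ψ (U ω, ξ ω)) ≤ expMoment μ (fun ω => Φ (U ω)) * C := by
  have hpair := (indepFun_iff_map_prod_eq_prod_map_map hU.aemeasurable hξ.aemeasurable).1 hind
  have := Measure.isProbabilityMeasure_map (μ := μ) hξ.aemeasurable
  calc expMoment μ (fun ω => Ψ (U ω, ξ ω))
      = ∫⁻ q, ENNReal.ofReal (Real.exp (Ψ q)) ∂(μ.map fun ω => (U ω, ξ ω)) := by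
        rw [lintegral_map (by fun_prop) (by fun_prop)]; rfl
    _ = ∫⁻ u, expMoment (μ.map ξ) (fun z => Ψ (u, z)) ∂(μ.map U) := by
        rw [hpair, lintegral_prod _ (by fun_prop)]; rfl
    _ ≤ ∫⁻ u, ENNReal.ofReal (Real.exp (Φ u)) * C ∂(μ.map U) := lintegral_mono h
    _ = _ := by
        rw [lintegral_mul_const _ (by fun_prop), lintegral_map (by fun_prop) hU]; rfl

/-- The information carried by the noise before time `t`. -/
abbrev noisePast (η : ℕ → Ω → Fin d → ℝ) (t : ℕ) : MeasurableSpace Ω :=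
  ⨆ i ∈ Set.Iio t, MeasurableSpace.comap (η i) inferInstance

theorem measurable_noisePast_state (hx0 : ∀ ω, x 0 ω = 0)
    (hx : ∀ t ω, x (t + 1) ω = A *ᵥ x t ω + η t ω) {s t : ℕ} (hst : s ≤ t) :
    Measurable[noisePast η t] (x s) := by
  induction s with
  | zero =>
    have : x 0 = fun _ => 0 := funext hx0
    rw [this]; exact measurable_const
  | succ s ih =>
    have h1 := ih (by omega)
    have h2 : Measurable[noisePast η t] (η s) := by
      refine Measurable.mono (comap_measurable (η s)) ?_ le_rfl
      exact le_iSup₂ (f := fun i (_ : i ∈ Set.Iio t) =>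
        MeasurableSpace.comap (η i) inferInstance) s (by simpa using hst)
    have : x (s + 1) = fun ω => A *ᵥ x s ω + η s ω := funext (hx s)
    rw [this]
    refine Measurable.add ?_ h2
    exact (Continuous.matrix_mulVec continuous_const continuous_id).measurable.comp h1

theorem indepFun_noisePast [MeasurableSpace Ω] {μ : Measure Ω} (hη : ∀ t, Measurable (η t))
    (hind : iIndepFun η μ) {β : Type*} [MeasurableSpace β] {U : Ω → β} {t : ℕ} (hU : Measurable[noisePast η t] U) :
    IndepFun U (η t) μ := by
  have h := indep_iSup_of_disjoint (m := fun i => MeasurableSpace.comap (η i) inferInstance)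
    (fun i => (hη i).comap_le) hind (S := Set.Iio t) (T := {t}) (by simp)
  simp only [Set.mem_singleton_iff, iSup_iSup_eq_left] at h
  exact indep_of_indep_of_le_left h hU.comap_le

theorem noisePast_le [MeasurableSpace Ω] (hη : ∀ t, Measurable (η t)) (t : ℕ) :
    noisePast η t ≤ inferInstanceAs (MeasurableSpace Ω) :=
  iSup₂_le fun i _ => (hη i).comap_le

/-- One step of the dynamics shifts the orbit index by one. Hence a single profile `w` serves at all
times, and `w (k + 1) - w k` is the slack available per step. -/
theorem mulVec_orbit_dotProduct (A : Matrix (Fin d) (Fin d) ℝ) (u y : Fin d → ℝ) (k : ℕ) :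
    ((Aᵀ ^ k) *ᵥ u) ⬝ᵥ (A *ᵥ y) = ((Aᵀ ^ (k + 1)) *ᵥ u) ⬝ᵥ y := by
  rw [pow_succ', ← Matrix.mulVec_mulVec, Matrix.mulVec_transpose, ← Matrix.dotProduct_mulVec]

variable [MeasurableSpace Ω] {μ : Measure Ω} [IsProbabilityMeasure μ]
  {ν : Measure (Fin d → ℝ)} {V : ℝ}

/-- The total squared length of the first `m` points of the orbit of `u`. -/
def orbitSum (A : Matrix (Fin d) (Fin d) ℝ) (u : Fin d → ℝ) (m : ℕ) : ℝ :=
  ∑ k ∈ Finset.range m, orbitSq A u k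

theorem orbitSum_nonneg (A : Matrix (Fin d) (Fin d) ℝ) (u : Fin d → ℝ) (m : ℕ) :
    0 ≤ orbitSum A u m := Finset.sum_nonneg fun _ _ => orbitSq_nonneg _ _ _

/-- The value function: the weighted squares of the future free evolution from `y`. -/
def valueFun (A : Matrix (Fin d) (Fin d) ℝ) (u : Fin d → ℝ) (w : ℕ → ℝ) (l : ℝ) (m : ℕ)
    (y : Fin d → ℝ) : ℝ :=
  ∑ k ∈ Finset.range m, (l + w (k + 1)) * (((Aᵀ ^ (k + 1)) *ᵥ u) ⬝ᵥ y) ^ 2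

theorem measurable_valueFun (A : Matrix (Fin d) (Fin d) ℝ) (u : Fin d → ℝ) (w : ℕ → ℝ) (l : ℝ)
    (m : ℕ) : Measurable (valueFun A u w l m) :=
  Finset.measurable_sum _ fun _ _ => ((measurable_dotProduct _).pow_const 2).const_mul _

/-- Because `w 0 = 0`, the current observation is the missing index `0` of the value function, so
both are handled by one application of the one-step estimate. -/
theorem sq_add_valueFun (A : Matrix (Fin d) (Fin d) ℝ) (u : Fin d → ℝ) {w : ℕ → ℝ} (hw : w 0 = 0)
    (l : ℝ) (m : ℕ) (y : Fin d → ℝ) :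
    l * (u ⬝ᵥ y) ^ 2 + valueFun A u w l m y
      = ∑ k ∈ Finset.range (m + 1), (l + w k) * (((Aᵀ ^ k) *ᵥ u) ⬝ᵥ y) ^ 2 := by
  rw [Finset.sum_range_succ', valueFun, hw]; simp [add_comm]

/-- The exponential supermartingale bound for the centred quadratic functional of the path. -/
theorem expMoment_path_le (hν : IsIsotropicSubGaussian ν V) (hη : ∀ t, Measurable (η t))
    (hind : iIndepFun η μ) (hlaw : ∀ t, μ.map (η t) = ν) (hx0 : ∀ ω, x 0 ω = 0)
    (hx : ∀ t ω, x (t + 1) ω = A *ᵥ x t ω + η t ω) (u : Fin d → ℝ) (w : ℕ → ℝ) (l : ℝ) (n : ℕ)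
    (hw0 : w 0 = 0) (hw : ∀ k, 0 ≤ w k)
    (hlT : ∀ m < n, 4 * |l| * V * orbitSum A u (m + 1) ≤ 1 / 16)
    (hvK : ∀ m < n, 4 * V * ∑ k ∈ Finset.range (m + 1), w k * orbitSq A u k ≤ 1 / 4)
    (hws : ∀ m < n, ∀ k, w k + 8 * V * l ^ 2 * orbitSum A u (m + 1)
      + 8 * V * (∑ k ∈ Finset.range (m + 1), w k * orbitSq A u k) * w k ≤ w (k + 1))
    (t : ℕ) (ht : t ≤ n) :
    expMoment μ (fun ω => l * (∑ s ∈ Finset.range t, (u ⬝ᵥ x (s + 1) ω) ^ 2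
        - ∑ s ∈ Finset.range t, orbitSum A u (n - 1 - s + 1)) + valueFun A u w l (n - t) (x t ω))
      ≤ ENNReal.ofReal (Real.exp (∑ s ∈ Finset.range t,
          (4096 * l ^ 2 * V ^ 2 * orbitSum A u (n - 1 - s + 1) ^ 2
            + 2 * V * ∑ k ∈ Finset.range (n - 1 - s + 1), w k * orbitSq A u k))) := by
  induction t with
  | zero => simp [hx0, valueFun, expMoment]
  | succ t ih =>
    have htn : t < n := by omega
    have hpast : ∀ s ≤ t, Measurable[noisePast η t] (x s) := fun s hs =>
      measurable_noisePast_state hx0 hx hs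
    let R : Ω → ℝ := fun ω => ∑ s ∈ Finset.range t, (u ⬝ᵥ x (s + 1) ω) ^ 2
    -- The running sum and the current state are all that the exponent at time `t + 1` uses besides
    -- `η t`.
    let U : Ω → ℝ × (Fin d → ℝ) := fun ω => (R ω, x t ω)
    have hU : Measurable[noisePast η t] U := by
      refine Measurable.prodMk ?_ (hpast t le_rfl)
      refine Finset.measurable_sum _ fun s hs => Measurable.pow_const ?_ 2
      exact (measurable_dotProduct u).comp (hpast (s + 1) (Finset.mem_range.1 hs))
    have hUm : Measurable U := hU.mono (noisePast_le hη t) le_rfl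
    have hprob : IsProbabilityMeasure ν :=
      hlaw 0 ▸ Measure.isProbabilityMeasure_map (hη 0).aemeasurable
    set m := n - 1 - t with hm
    have hmn : m < n := by omega
    have hm1 : n - t = m + 1 := by omega
    have hm2 : n - (t + 1) = m := by omega
    set S := ∑ s ∈ Finset.range t, orbitSum A u (n - 1 - s + 1) with hS
    let Ψ : (ℝ × (Fin d → ℝ)) × (Fin d → ℝ) → ℝ := fun q =>
      l * (q.1.1 + (u ⬝ᵥ (A *ᵥ q.1.2 + q.2)) ^ 2 - (S + orbitSum A u (m + 1)))
        + valueFun A u w l m (A *ᵥ q.1.2 + q.2)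
    let Φ : ℝ × (Fin d → ℝ) → ℝ := fun q => l * (q.1 - S) + valueFun A u w l (m + 1) q.2
    have hlin : Measurable fun q : (ℝ × (Fin d → ℝ)) × (Fin d → ℝ) => A *ᵥ q.1.2 + q.2 :=
      ((Continuous.matrix_mulVec continuous_const (by fun_prop)).add (by fun_prop)).measurable
    have hΨ : Measurable Ψ := by
      have h1 := (measurable_dotProduct u).comp hlin
      have h2 := (measurable_valueFun A u w l m).comp hlin
      exact (((by fun_prop : Measurable fun q : (ℝ × (Fin d → ℝ)) × (Fin d → ℝ) => q.1.1).add
        (h1.pow_const 2)).sub_const _).const_mul l |>.add h2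
    have hΦ : Measurable Φ :=
      ((measurable_fst.sub_const S).const_mul l).add
        ((measurable_valueFun A u w l (m + 1)).comp measurable_snd)
    have hstep := expMoment_le_of_indepFun hUm (hη t) (indepFun_noisePast hη hind hU) hΨ hΦ
      (ENNReal.ofReal (Real.exp (4096 * l ^ 2 * V ^ 2 * orbitSum A u (m + 1) ^ 2
            + 2 * V * ∑ k ∈ Finset.range (m + 1), w k * orbitSq A u k))) (fun q => by
        rw [hlaw t]
        have h := hν.expMoment_step (Finset.range (m + 1)) (fun k => (Aᵀ ^ k) *ᵥ u) w
          (fun k => w (k + 1)) l (A *ᵥ q.2) (fun k _ => hw k) (T := orbitSum A u (m + 1)) rfl rfl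
          (hlT m hmn) (hvK m hmn) (fun k _ => hws m hmn k)
        have e : (fun z => Ψ (q, z)) = fun z => (∑ k ∈ Finset.range (m + 1),
            (l + w k) * (((Aᵀ ^ k) *ᵥ u) ⬝ᵥ (A *ᵥ q.2 + z)) ^ 2 - l * orbitSum A u (m + 1))
            + l * (q.1 - S) := by
          funext z
          rw [← sq_add_valueFun A u hw0]
          simp only [Ψ]; ring
        rw [e, expMoment_add_const]
        refine (mul_le_mul_left h _).trans (le_of_eq ?_)
        rw [← ENNReal.ofReal_mul (Real.exp_pos _).le, ← ENNReal.ofReal_mul (Real.exp_pos _).le,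
          ← Real.exp_add, ← Real.exp_add]
        congr 2
        simp only [Φ, valueFun, mulVec_orbit_dotProduct]
        simp only [orbitSq]
        ring)
    have hgoal : (fun ω => l * (∑ s ∈ Finset.range (t + 1), (u ⬝ᵥ x (s + 1) ω) ^ 2
        - ∑ s ∈ Finset.range (t + 1), orbitSum A u (n - 1 - s + 1))
        + valueFun A u w l (n - (t + 1)) (x (t + 1) ω)) = fun ω => Ψ (U ω, η t ω) := by
      funext ω
      rw [hm2, Finset.sum_range_succ, Finset.sum_range_succ, hx]
    rw [hgoal, Finset.sum_range_succ, Real.exp_add, ENNReal.ofReal_mul (Real.exp_pos _).le]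
    refine hstep.trans (mul_le_mul_left ?_ _)
    have := ih htn.le
    rw [hm1] at this
    exact this

/-- The supermartingale groups variance by noise, `η s` entering the last `n - s` observations; the
Gramians group it by observation. The totals agree. -/
theorem sum_orbitSum_reflect (A : Matrix (Fin d) (Fin d) ℝ) (u : Fin d → ℝ) (n : ℕ) :
    ∑ s ∈ Finset.range n, orbitSum A u (n - 1 - s + 1)
      = ∑ s ∈ Finset.range n, orbitSum A u (s + 1) :=
  Finset.sum_range_reflect (fun s => orbitSum A u (s + 1)) n

/-- The recursion `w (k + 1) = θ w k + b` meets the one-step requirement: `b` covers the `l²` term,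
and `θ - 1 = 1/(2p)` covers the term proportional to `w k` once `8 V K ≤ 1/(2p)`, `K` being the
weighted orbit sum. As `K` is of order `l²`, this holds for the small `|l|` chosen. -/
theorem expMoment_path_le_of_orbitBound {p : ℝ} (hA : HasOrbitBound A p)
    (hν : IsIsotropicSubGaussian ν V) (hη : ∀ t, Measurable (η t))
    (hind : iIndepFun η μ) (hlaw : ∀ t, μ.map (η t) = ν) (hx0 : ∀ ω, x 0 ω = 0)
    (hx : ∀ t ω, x (t + 1) ω = A *ᵥ x t ω + η t ω) {u : Fin d → ℝ} (hu : u ≠ 0) (n : ℕ)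
    {l : ℝ} (hl : |l| = (131072 * V ^ 2 * p ^ 3 * (u ⬝ᵥ u))⁻¹) :
    expMoment μ (fun ω => l * (∑ s ∈ Finset.range n, (u ⬝ᵥ x (s + 1) ω) ^ 2
        - ∑ s ∈ Finset.range n, orbitSum A u (s + 1)))
      ≤ ENNReal.ofReal (Real.exp (|l| * (∑ s ∈ Finset.range n, orbitSum A u (s + 1)) / 16)) := by
  have hp := hA.one_le
  have hV := hν.half_le
  have hp0 : 0 < p := by linarith
  have hV0 : 0 < V := by linarith
  have hN : 0 < u ⬝ᵥ u := lt_of_le_of_ne (dotProduct_self_nonneg' u) (by simpa [eq_comm] using hu)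
  set N := u ⬝ᵥ u with hNdef
  have hl0 : 0 ≤ |l| := abs_nonneg l
  have hl1 : |l| * (V ^ 2 * p ^ 3 * N) = 1 / 131072 := by rw [hl]; field_simp
  have hl2 : l ^ 2 = |l| ^ 2 := (sq_abs l).symm
  have hT : ∀ m, orbitSum A u m ≤ p * N := fun m => hA.sum_le u m
  have hT0 := orbitSum_nonneg A u
  set θ := 1 + 1 / (2 * p) with hθ
  set b := 8 * V * l ^ 2 * (p * N) with hb
  have hb0 : 0 ≤ b := by positivity
  have hθ0 : 0 ≤ θ := by positivity
  set w := geomWeight b θ with hw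
  have hK : ∀ m, ∑ k ∈ Finset.range m, w k * orbitSq A u k ≤ 2 * p ^ 2 * b * orbitSum A u m :=
    fun m => hA.sum_geomWeight_le u hb0 m
  have hq' : |l| * V * p ^ 2 * N ≤ 2 / 131072 := by
    have h1 : |l| * V * p ^ 2 * N * (V * p) = 1 / 131072 := by rw [← hl1]; ring
    have h2 : 1 / 2 ≤ V * p := by nlinarith
    have h3 : 0 ≤ |l| * V * p ^ 2 * N := by positivity
    nlinarith
  have hq : |l| * V * p * N ≤ 2 / 131072 := by
    refine le_trans ?_ hq'
    gcongr
    nlinarith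
  have hKsmall : ∀ m, 8 * V * ∑ k ∈ Finset.range m, w k * orbitSq A u k ≤ 1 / (2 * p) := by
    intro m
    calc 8 * V * ∑ k ∈ Finset.range m, w k * orbitSq A u k
        ≤ 8 * V * (2 * p ^ 2 * b * (p * N)) := by
          gcongr; exact (hK m).trans (by gcongr; exact hT m)
      _ = 128 * (1 / 131072) * (|l| * V * p ^ 2 * N) / (V * p) := by
          rw [hb, hl2, ← hl1]; field_simp; ring
      _ ≤ 128 * (1 / 131072) * (2 / 131072) / (1 / 2 * p) := by gcongr
      _ ≤ 1 / (2 * p) := by rw [div_le_div_iff₀ (by positivity) (by positivity)]; linarith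
  have hmain := expMoment_path_le hν hη hind hlaw hx0 hx u w l n (geomWeight_zero b θ)
    (geomWeight_nonneg hb0 hθ0) (fun m _ => by
      calc 4 * |l| * V * orbitSum A u (m + 1) ≤ 4 * |l| * V * (p * N) := by gcongr; exact hT _
        _ = 4 * (|l| * V * p * N) := by ring
        _ ≤ 1 / 16 := by linarith)
    (fun m _ => by
      have h1 := hKsmall (m + 1)
      have : 1 / (2 * p) ≤ 1 / 2 := by
        apply one_div_le_one_div_of_le <;> linarith
      linarith)
    (fun m _ k => by
      have h1 : 8 * V * l ^ 2 * orbitSum A u (m + 1) ≤ b := by rw [hb]; gcongr; exact hT _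
      have h2 := mul_le_mul_of_nonneg_right (hKsmall (m + 1)) (geomWeight_nonneg hb0 hθ0 k)
      rw [hw] at h2 ⊢
      rw [geomWeight_succ, hθ, add_mul]
      rw [hθ] at h2
      linarith)
    n le_rfl
  rw [sum_orbitSum_reflect] at hmain
  simp only [Nat.sub_self, valueFun, Finset.range_zero, Finset.sum_empty, add_zero] at hmain
  refine hmain.trans (ENNReal.ofReal_le_ofReal (Real.exp_le_exp.2 ?_))
  rw [← sum_orbitSum_reflect, Finset.mul_sum, Finset.sum_div]
  refine Finset.sum_le_sum fun s _ => ?_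
  set T := orbitSum A u (n - 1 - s + 1) with hTdef
  have hTs : T ≤ p * N := hT _
  have hTnn : 0 ≤ T := hT0 _
  -- One factor `T` is retained, so that the total cost is proportional to the variance `S` and not
  -- merely to `n p N`.
  calc _ ≤ 4096 * l ^ 2 * V ^ 2 * (T * (p * N)) + 2 * V * (2 * p ^ 2 * b * T) := by
        rw [sq T]; gcongr; exact hK _
    _ = |l| * T * (4096 * (|l| * V ^ 2 * p * N * 1) + 32 * (|l| * (V ^ 2 * p ^ 3 * N))) := by
        rw [hb, hl2]; ring
    _ ≤ |l| * T * (4096 * (|l| * V ^ 2 * p * N * p ^ 2)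
          + 32 * (|l| * (V ^ 2 * p ^ 3 * N))) := by
        gcongr; exact one_le_pow₀ hp
    _ = |l| * T * (4128 * (|l| * (V ^ 2 * p ^ 3 * N))) := by ring
    _ ≤ |l| * T * (1 / 16) := by rw [hl1]; gcongr; norm_num
    _ = |l| * T / 16 := by ring

/-- Two-sided concentration of the quadratic functional of the path in a fixed direction. -/
theorem measure_path_deviation_le {p : ℝ} (hA : HasOrbitBound A p)
    (hν : IsIsotropicSubGaussian ν V) (hη : ∀ t, Measurable (η t))
    (hind : iIndepFun η μ) (hlaw : ∀ t, μ.map (η t) = ν) (hx0 : ∀ ω, x 0 ω = 0)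
    (hx : ∀ t ω, x (t + 1) ω = A *ᵥ x t ω + η t ω) {u : Fin d → ℝ} (hu : u ≠ 0) (n : ℕ)
    {S : ℝ} (hS : S = ∑ s ∈ Finset.range n, orbitSum A u (s + 1)) :
    μ {ω | S / 8 < |∑ s ∈ Finset.range n, (u ⬝ᵥ x (s + 1) ω) ^ 2 - S|}
      ≤ ENNReal.ofReal (2 * Real.exp (-(S / (2097152 * V ^ 2 * p ^ 3 * (u ⬝ᵥ u))))) := by
  have hp0 : 0 < p := by linarith [hA.one_le]
  have hV0 : 0 < V := by linarith [hν.half_le]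
  have hN : 0 < u ⬝ᵥ u := lt_of_le_of_ne (dotProduct_self_nonneg' u) (by simpa [eq_comm] using hu)
  set c := (131072 * V ^ 2 * p ^ 3 * (u ⬝ᵥ u))⁻¹ with hc
  have hc0 : 0 < c := by positivity
  set D : Ω → ℝ := fun ω => ∑ s ∈ Finset.range n, (u ⬝ᵥ x (s + 1) ω) ^ 2 - S with hD
  have hxm : ∀ s, Measurable (x s) := fun s =>
    (measurable_noisePast_state hx0 hx le_rfl).mono (noisePast_le hη s) le_rfl
  have hDm : Measurable D := (Finset.measurable_sum _ fun s _ =>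
    ((measurable_dotProduct u).comp (hxm (s + 1))).pow_const 2).sub_const _
  -- Markov's inequality at `l = ± c`: the moment bound `c S / 16` against the threshold `c S / 8`
  -- leaves `-c S / 16`.
  have htail : ∀ l : ℝ, |l| = c →
      μ {ω | c * S / 8 ≤ l * D ω} ≤ ENNReal.ofReal (Real.exp (-(c * S / 16))) := by
    intro l hl
    have hE := expMoment_path_le_of_orbitBound hA hν hη hind hlaw hx0 hx hu n (hl.trans hc)
    rw [← hS, hl] at hE
    have hE1 : expMoment μ (fun ω => l * D ω - c * S / 8)
        ≤ ENNReal.ofReal (Real.exp (-(c * S / 16))) := by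
      simp only [sub_eq_add_neg (_ * D _)]
      rw [expMoment_add_const]
      refine (mul_le_mul_left hE _).trans (le_of_eq ?_)
      rw [← ENNReal.ofReal_mul (Real.exp_pos _).le, ← Real.exp_add]
      congr 2; ring
    refine le_trans ?_ hE1
    calc μ {ω | c * S / 8 ≤ l * D ω}
        ≤ μ {ω | 1 ≤ ENNReal.ofReal (Real.exp (l * D ω - c * S / 8))} := by
          refine measure_mono fun ω hω => ?_
          simp only [Set.mem_ofPred_eq] at hω ⊢
          rw [ENNReal.one_le_ofReal, Real.one_le_exp_iff]
          linarith
      _ ≤ _ := by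
          have := mul_meas_ge_le_lintegral₀ (μ := μ)
            (f := fun ω => ENNReal.ofReal (Real.exp (l * D ω - c * S / 8)))
            (Measurable.aemeasurable (by fun_prop)) 1
          simpa [expMoment] using this
  have hexp : S / (2097152 * V ^ 2 * p ^ 3 * (u ⬝ᵥ u)) = c * S / 16 := by
    rw [hc]; field_simp; ring
  rw [hexp, two_mul, ENNReal.ofReal_add (Real.exp_pos _).le (Real.exp_pos _).le]
  refine le_trans ?_ (add_le_add (htail c (abs_of_pos hc0))
    (htail (-c) (by rw [abs_neg, abs_of_pos hc0])))
  refine (measure_mono fun ω hω => ?_).trans (measure_union_le _ _)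
  simp only [Set.mem_ofPred_eq, Set.mem_union] at hω ⊢
  rcases lt_abs.1 hω with h | h
  · left; have := mul_le_mul_of_nonneg_left h.le hc0.le; simp only [hD]; linarith
  · right; have := mul_le_mul_of_nonneg_left h.le hc0.le; simp only [hD]; linarith

end Trajectory

/-! ### Stability, Gramians and the Lyapunov equation -/

section Gramian

variable {d : ℕ}

open scoped Matrix.Norms.Operator in
theorem norm_entry_le_linfty_opNorm (M : Matrix (Fin d) (Fin d) ℂ) (i j : Fin d) :
    ‖M i j‖ ≤ ‖M‖ := by
  have h1 : ‖M i j‖₊ ≤ ∑ j, ‖M i j‖₊ :=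
    Finset.single_le_sum (f := fun j => ‖M i j‖₊) (fun _ _ => zero_le) (Finset.mem_univ j)
  have h2 : ∑ j, ‖M i j‖₊ ≤ ‖M‖₊ := by
    rw [Matrix.linfty_opNNNorm_def]
    exact Finset.le_sup (f := fun i => ∑ j, ‖M i j‖₊) (Finset.mem_univ i)
  exact_mod_cast h1.trans h2

open scoped Matrix.Norms.Operator in
/-- The entries of the powers of a stable matrix decay geometrically. -/
theorem IsStable.exists_entry_le {A : Matrix (Fin d) (Fin d) ℝ} (hA : IsStable A) :
    ∃ r : ℝ, 0 ≤ r ∧ r < 1 ∧ ∀ᶠ k in Filter.atTop, ∀ i j, |(A ^ k) i j| ≤ r ^ k := by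
  obtain ⟨r, hr1, hr2⟩ := ENNReal.lt_iff_exists_nnreal_btwn.1 hA
  refine ⟨r, r.2, by exact_mod_cast hr2, ?_⟩
  -- Gelfand's formula, with `r` strictly between the spectral radius and `1`.
  have hlim := spectrum.pow_nnnorm_pow_one_div_tendsto_nhds_spectralRadius (A.map Complex.ofReal)
  filter_upwards [hlim.eventually_lt_const hr1, Filter.eventually_gt_atTop 0] with k hk hk0 i j
  have h1 : ((‖A.map Complex.ofReal ^ k‖₊ : ENNReal) ^ (1 / (k : ℝ))) ^ (k : ℝ)
      ≤ (r : ENNReal) ^ (k : ℝ) := ENNReal.rpow_le_rpow hk.le (by positivity)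
  have hk' : (k : ℝ) ≠ 0 := by positivity
  rw [← ENNReal.rpow_mul, one_div_mul_cancel hk', ENNReal.rpow_one, ENNReal.rpow_natCast] at h1
  have h2 : ‖A.map Complex.ofReal ^ k‖ ≤ (r : ℝ) ^ k := by exact_mod_cast h1
  have h3 : A.map Complex.ofReal ^ k = (A ^ k).map Complex.ofReal :=
    (map_pow (RingHom.mapMatrix Complex.ofRealHom) A k).symm
  have h4 := (norm_entry_le_linfty_opNorm (A.map Complex.ofReal ^ k) i j).trans h2
  rw [h3, Matrix.map_apply, Complex.norm_real, Real.norm_eq_abs] at h4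
  exact h4

theorem IsStable.summable {A : Matrix (Fin d) (Fin d) ℝ} (hA : IsStable A) :
    Summable fun k : ℕ => A ^ k * (A ^ k)ᵀ := by
  obtain ⟨r, hr0, hr1, h⟩ := hA.exists_entry_le
  refine Pi.summable.2 fun i => Pi.summable.2 fun j => ?_
  have hgeom : Summable fun k : ℕ => (d : ℝ) * (r ^ 2) ^ k :=
    (summable_geometric_of_lt_one (by positivity) (by nlinarith)).mul_left _
  refine summable_of_isBigO_nat hgeom (Asymptotics.IsBigO.of_bound 1 ?_)
  filter_upwards [h] with k hk
  rw [one_mul, Real.norm_eq_abs, Real.norm_of_nonneg (by positivity), Matrix.mul_apply]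
  calc |∑ l, (A ^ k) i l * (A ^ k)ᵀ l j| ≤ ∑ l, |(A ^ k) i l * (A ^ k)ᵀ l j| :=
        Finset.abs_sum_le_sum_abs _ _
    _ ≤ ∑ _l : Fin d, r ^ k * r ^ k := by
        refine Finset.sum_le_sum fun l _ => ?_
        rw [abs_mul, Matrix.transpose_apply]
        exact mul_le_mul (hk i l) (hk j l) (abs_nonneg _) (by positivity)
    _ = _ := by simp [← pow_mul, ← pow_add, mul_comm 2, mul_two]

theorem dotProduct_pow_mul_transpose (A : Matrix (Fin d) (Fin d) ℝ) (u : Fin d → ℝ) (k : ℕ) :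
    u ⬝ᵥ ((A ^ k * (A ^ k)ᵀ) *ᵥ u) = orbitSq A u k := by
  rw [← Matrix.mulVec_mulVec, Matrix.dotProduct_mulVec, ← Matrix.mulVec_transpose,
    Matrix.transpose_pow, orbitSq]

theorem dotProduct_gramian (A : Matrix (Fin d) (Fin d) ℝ) (u : Fin d → ℝ) (t : ℕ) :
    u ⬝ᵥ (gramian A t *ᵥ u) = orbitSum A u (t + 1) := by
  simp only [gramian, Matrix.sum_mulVec, dotProduct_sum, dotProduct_pow_mul_transpose, orbitSum]

theorem dotProduct_avgCov (A : Matrix (Fin d) (Fin d) ℝ) (u : Fin d → ℝ) (n : ℕ) :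
    u ⬝ᵥ (avgCov A n *ᵥ u) = (n : ℝ)⁻¹ * ∑ s ∈ Finset.range n, orbitSum A u (s + 1) := by
  simp only [avgCov, Matrix.smul_mulVec, dotProduct_smul, smul_eq_mul, Matrix.sum_mulVec,
    dotProduct_sum, dotProduct_gramian]

theorem dotProduct_empCov (y : ℕ → Fin d → ℝ) (u : Fin d → ℝ) (n : ℕ) :
    u ⬝ᵥ (empCov y n *ᵥ u) = (n : ℝ)⁻¹ * ∑ s ∈ Finset.range n, (u ⬝ᵥ y (s + 1)) ^ 2 := by
  rw [empCov, Matrix.smul_mulVec, dotProduct_smul, smul_eq_mul, ← Matrix.mulVec_mulVec,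
    Matrix.dotProduct_mulVec, ← Matrix.mulVec_transpose, Matrix.transpose_transpose,
    Finset.sum_range fun s => (u ⬝ᵥ y (s + 1)) ^ 2]
  congr 1
  refine Finset.sum_congr rfl fun s _ => ?_
  have : (dataMatrix y n *ᵥ u) s = u ⬝ᵥ y (s + 1) := dotProduct_comm _ _
  rw [this, sq]

theorem IsStable.hasSum_orbitSq {A : Matrix (Fin d) (Fin d) ℝ} (hA : IsStable A)
    (u : Fin d → ℝ) : HasSum (orbitSq A u) (u ⬝ᵥ (gramianInf A *ᵥ u)) := by
  have h := hA.summable.hasSum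
  have hc : Continuous fun M : Matrix (Fin d) (Fin d) ℝ => u ⬝ᵥ (M *ᵥ u) :=
    Continuous.dotProduct continuous_const (Continuous.matrix_mulVec continuous_id continuous_const)
  have h1 := h.map (AddMonoidHom.mk' (fun M : Matrix (Fin d) (Fin d) ℝ => u ⬝ᵥ (M *ᵥ u))
    fun M N => by simp [Matrix.add_mulVec]) hc
  have h2 : (AddMonoidHom.mk' (fun M : Matrix (Fin d) (Fin d) ℝ => u ⬝ᵥ (M *ᵥ u))
      fun M N => by simp [Matrix.add_mulVec]) ∘ (fun k : ℕ => A ^ k * (A ^ k)ᵀ) = orbitSq A u :=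
    funext fun k => dotProduct_pow_mul_transpose A u k
  rwa [h2] at h1

theorem dotProduct_mulVec_le_opNorm (M : Matrix (Fin d) (Fin d) ℝ) (u : Fin d → ℝ) :
    u ⬝ᵥ (M *ᵥ u) ≤ opNorm M * (u ⬝ᵥ u) := by
  have h1 := Matrix.inner_toEuclideanCLM M (WithLp.toLp 2 u) (WithLp.toLp 2 u)
  have h2 : ‖WithLp.toLp 2 u‖ ^ 2 = u ⬝ᵥ u := by
    rw [EuclideanSpace.real_norm_sq_eq]; simp [dotProduct, sq]
  have h3 := real_inner_le_norm (WithLp.toLp 2 u)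
    (Matrix.toEuclideanCLM (n := Fin d) (𝕜 := ℝ) M (WithLp.toLp 2 u))
  have h4 := (Matrix.toEuclideanCLM (n := Fin d) (𝕜 := ℝ) M).le_opNorm (WithLp.toLp 2 u)
  rw [h1] at h3
  calc u ⬝ᵥ (M *ᵥ u) ≤ _ := h3
    _ ≤ ‖WithLp.toLp 2 u‖ * (opNorm M * ‖WithLp.toLp 2 u‖) := by gcongr; exact h4
    _ = _ := by rw [← h2]; ring

section Stable

variable {A : Matrix (Fin d) (Fin d) ℝ}

/-- The quadratic form of the infinite-time Gramian. -/
noncomputable def gramForm (A : Matrix (Fin d) (Fin d) ℝ) (u : Fin d → ℝ) : ℝ :=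
  u ⬝ᵥ (gramianInf A *ᵥ u)

/-- The Lyapunov equation `Γ_∞ = I + A Γ_∞ Aᵀ`, read off by splitting the first term from the
series. -/
theorem IsStable.gramForm_step (hA : IsStable A) (u : Fin d → ℝ) :
    gramForm A u = u ⬝ᵥ u + gramForm A (Aᵀ *ᵥ u) := by
  have h1 := hA.hasSum_orbitSq (Aᵀ *ᵥ u)
  have h2 : orbitSq A (Aᵀ *ᵥ u) = fun k => orbitSq A u (k + 1) := by
    funext k
    have := orbitSq_add A u k 1
    rwa [pow_one, add_comm] at this
  rw [h2] at h1
  have h3 := (hasSum_nat_add_iff 1).1 h1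
  have h4 := h3.unique (hA.hasSum_orbitSq u)
  simp only [Finset.sum_range_one, orbitSq, pow_zero, Matrix.one_mulVec] at h4
  unfold gramForm
  linarith

theorem IsStable.orbitSum_le_gramForm (hA : IsStable A) (u : Fin d → ℝ) (m : ℕ) :
    orbitSum A u m ≤ gramForm A u :=
  sum_le_hasSum _ (fun _ _ => orbitSq_nonneg A u _) (hA.hasSum_orbitSq u)

theorem IsStable.dotProduct_self_le_gramForm (hA : IsStable A) (u : Fin d → ℝ) :
    u ⬝ᵥ u ≤ gramForm A u := by
  simpa [orbitSum, orbitSq] using hA.orbitSum_le_gramForm u 1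

theorem IsStable.one_le_opNorm (hA : IsStable A) (hd : 0 < d) : 1 ≤ opNorm (gramianInf A) := by
  let u : Fin d → ℝ := Pi.single ⟨0, hd⟩ 1
  have hu : u ⬝ᵥ u = 1 := by simp [u]
  have h1 := hA.dotProduct_self_le_gramForm u
  have h2 := dotProduct_mulVec_le_opNorm (gramianInf A) u
  unfold gramForm at h1
  rw [hu] at h1 h2
  linarith

/-- The form of `Γ_∞` is a Lyapunov function: each step loses `y ⬝ᵥ y`, which is at least the
fraction `1 / ‖Γ_∞‖` of its value at `y`. -/
theorem IsStable.gramForm_pow_le (hA : IsStable A) (hd : 0 < d) (u : Fin d → ℝ) (k : ℕ) :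
    gramForm A ((Aᵀ ^ k) *ᵥ u) ≤ (1 - 1 / opNorm (gramianInf A)) ^ k * gramForm A u := by
  have hp := hA.one_le_opNorm hd
  set p := opNorm (gramianInf A) with hpdef
  have hp1 : 0 ≤ 1 - 1 / p := by
    rw [sub_nonneg, div_le_one (by linarith)]; exact hp
  induction k with
  | zero => simp
  | succ k ih =>
    set y := (Aᵀ ^ k) *ᵥ u with hy
    have h0 : (Aᵀ ^ (k + 1)) *ᵥ u = Aᵀ *ᵥ y := by
      rw [hy, Matrix.mulVec_mulVec, pow_succ']
    have h1 := hA.gramForm_step y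
    have h2 : gramForm A y ≤ p * (y ⬝ᵥ y) := dotProduct_mulVec_le_opNorm _ y
    have h3 : 1 / p * gramForm A y ≤ y ⬝ᵥ y := by
      rw [one_div, inv_mul_le_iff₀ (by linarith)]; exact h2
    rw [h0, pow_succ']
    calc gramForm A (Aᵀ *ᵥ y) ≤ (1 - 1 / p) * gramForm A y := by linarith
      _ ≤ (1 - 1 / p) * ((1 - 1 / p) ^ k * gramForm A u) := by gcongr
      _ = _ := by ring

/-- The rate `1 + 1/(2p)` uses up half of the decay `1 - 1/p`; the remaining ratio `1 - 1/(2p)` sums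
to `2p`, and a further `p` compares the form of `Γ_∞` with `u ⬝ᵥ u`. -/
theorem IsStable.hasOrbitBound (hA : IsStable A) (hd : 0 < d) :
    HasOrbitBound A (opNorm (gramianInf A)) := by
  have hp := hA.one_le_opNorm hd
  set p := opNorm (gramianInf A) with hpdef
  have hp0 : 0 < p := by linarith
  have hform : ∀ u, gramForm A u ≤ p * (u ⬝ᵥ u) := fun u => dotProduct_mulVec_le_opNorm _ u
  refine ⟨hp, fun u m => (hA.orbitSum_le_gramForm u m).trans (hform u), fun u m => ?_⟩
  have hp1 : 0 ≤ 1 - 1 / p := by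
    rw [sub_nonneg, div_le_one (by linarith)]; exact hp
  have hq : (1 + 1 / (2 * p)) * (1 - 1 / p) ≤ 1 - 1 / (2 * p) := by
    have : (1 + 1 / (2 * p)) * (1 - 1 / p) = 1 - 1 / (2 * p) - 1 / (2 * p ^ 2) := by
      field_simp; ring
    rw [this]
    have : 0 ≤ 1 / (2 * p ^ 2) := by positivity
    linarith
  have hr0 : 0 ≤ 1 - 1 / (2 * p) := le_trans (by positivity) hq
  have hr1 : 1 - 1 / (2 * p) < 1 := by
    have : 0 < 1 / (2 * p) := by positivity
    linarith
  have hnn := dotProduct_self_nonneg' u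
  calc ∑ k ∈ Finset.range m, (1 + 1 / (2 * p)) ^ k * orbitSq A u k
      ≤ ∑ k ∈ Finset.range m, (1 - 1 / (2 * p)) ^ k * (p * (u ⬝ᵥ u)) := by
        refine Finset.sum_le_sum fun k _ => ?_
        have h1 : orbitSq A u k ≤ (1 - 1 / p) ^ k * (p * (u ⬝ᵥ u)) :=
          (hA.dotProduct_self_le_gramForm _).trans ((hA.gramForm_pow_le hd u k).trans (by
            gcongr; exact hform u))
        calc (1 + 1 / (2 * p)) ^ k * orbitSq A u k
            ≤ (1 + 1 / (2 * p)) ^ k * ((1 - 1 / p) ^ k * (p * (u ⬝ᵥ u))) := by gcongr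
          _ = ((1 + 1 / (2 * p)) * (1 - 1 / p)) ^ k * (p * (u ⬝ᵥ u)) := by
              rw [mul_pow]; ring
          _ ≤ _ := by gcongr
    _ = (∑ k ∈ Finset.range m, (1 - 1 / (2 * p)) ^ k) * (p * (u ⬝ᵥ u)) := by
        rw [Finset.sum_mul]
    _ ≤ (2 * p) * (p * (u ⬝ᵥ u)) := by
        gcongr
        refine (sum_le_hasSum _ (fun _ _ => by positivity)
          (hasSum_geometric_of_lt_one hr0 hr1)).trans (le_of_eq ?_)
        simp
    _ = _ := by ring

/-- The tail missing from the `s`-th Gramian decays like `(1 - 1/p)^s`, so the tails add up to at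
most `p` times the full form, and averaging loses the fraction `p / n ≤ 1/2`. -/
theorem IsStable.half_gramForm_le_avgCov (hA : IsStable A) (hd : 0 < d) (u : Fin d → ℝ) {n : ℕ}
    (hn : 2 * opNorm (gramianInf A) ≤ n) :
    1 / 2 * gramForm A u ≤ u ⬝ᵥ (avgCov A n *ᵥ u) := by
  have hp := hA.one_le_opNorm hd
  set p := opNorm (gramianInf A) with hpdef
  have hp0 : 0 < p := by linarith
  have hn0 : (0 : ℝ) < n := by linarith
  have hp1 : 0 ≤ 1 - 1 / p := by
    rw [sub_nonneg, div_le_one (by linarith)]; exact hp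
  have hp2 : 1 - 1 / p < 1 := by
    have : 0 < 1 / p := by positivity
    linarith
  have hψ : 0 ≤ gramForm A u := (dotProduct_self_nonneg' u).trans (hA.dotProduct_self_le_gramForm u)
  have htail : ∀ m, gramForm A u = orbitSum A u m + gramForm A ((Aᵀ ^ m) *ᵥ u) := by
    intro m
    induction m with
    | zero => simp [orbitSum]
    | succ m ih =>
      rw [ih, orbitSum, orbitSum, Finset.sum_range_succ, hA.gramForm_step ((Aᵀ ^ m) *ᵥ u),
        Matrix.mulVec_mulVec, ← pow_succ', orbitSq]
      ring
  have hsum : (n - p) * gramForm A u ≤ ∑ s ∈ Finset.range n, orbitSum A u (s + 1) := by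
    have h1 : ∑ s ∈ Finset.range n, (1 - (1 - 1 / p) ^ s) * gramForm A u
        ≤ ∑ s ∈ Finset.range n, orbitSum A u (s + 1) := by
      refine Finset.sum_le_sum fun s _ => ?_
      have h2 := htail (s + 1)
      have h3 := hA.gramForm_pow_le hd u (s + 1)
      have h4 : (1 - 1 / p) ^ (s + 1) * gramForm A u ≤ (1 - 1 / p) ^ s * gramForm A u := by
        gcongr ?_ * _
        exact pow_le_pow_of_le_one hp1 hp2.le (Nat.le_succ s)
      linarith
    refine le_trans ?_ h1
    rw [← Finset.sum_mul, Finset.sum_sub_distrib]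
    gcongr
    · simp
    · refine (sum_le_hasSum _ (fun _ _ => by positivity)
        (hasSum_geometric_of_lt_one hp1 hp2)).trans (le_of_eq ?_)
      simp
  rw [dotProduct_avgCov, ← div_eq_inv_mul, le_div_iff₀ hn0]
  refine le_trans ?_ hsum
  nlinarith

theorem IsStable.avgCov_le_gramForm (hA : IsStable A) (u : Fin d → ℝ) {n : ℕ} (hn : 1 ≤ n) :
    u ⬝ᵥ (avgCov A n *ᵥ u) ≤ gramForm A u := by
  have hn0 : (0 : ℝ) < n := by exact_mod_cast hn
  rw [dotProduct_avgCov, ← div_eq_inv_mul, div_le_iff₀ hn0]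
  calc _ ≤ ∑ s ∈ Finset.range n, gramForm A u :=
        Finset.sum_le_sum fun s _ => hA.orbitSum_le_gramForm u _
    _ = _ := by simp [mul_comm]

end Stable

theorem dotProduct_self_le_avgCov (A : Matrix (Fin d) (Fin d) ℝ) (u : Fin d → ℝ) {n : ℕ}
    (hn : 1 ≤ n) : u ⬝ᵥ u ≤ u ⬝ᵥ (avgCov A n *ᵥ u) := by
  have hn0 : (0 : ℝ) < n := by exact_mod_cast hn
  rw [dotProduct_avgCov, ← div_eq_inv_mul, le_div_iff₀ hn0]
  calc u ⬝ᵥ u * n = ∑ s ∈ Finset.range n, u ⬝ᵥ u := by simp [mul_comm]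
    _ ≤ _ := Finset.sum_le_sum fun s _ => by
        have : orbitSq A u 0 = u ⬝ᵥ u := by simp [orbitSq]
        rw [← this]
        exact Finset.single_le_sum (fun k _ => orbitSq_nonneg A u k) (by simp)

end Gramian

/-! ### Ordered eigenvalues, whitening and nets -/

section Spectral

variable {d : ℕ}

/-- An orthonormal basis of eigenvectors, in coordinates. -/
theorem exists_eigenbasis {M : Matrix (Fin d) (Fin d) ℝ} (hM : M.IsHermitian) :
    ∃ b : Fin d → Fin d → ℝ, (∀ j, M *ᵥ b j = eig hM j • b j) ∧
      (∀ i j, b i ⬝ᵥ b j = if i = j then 1 else 0) ∧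
      (∀ u, ∑ j, (b j ⬝ᵥ u) ^ 2 = u ⬝ᵥ u) ∧
      ∀ u, ∑ j, eig hM j * (b j ⬝ᵥ u) ^ 2 = u ⬝ᵥ (M *ᵥ u) := by
  have hsymm := Matrix.isSymmetric_toEuclideanLin_iff.mpr hM
  set B := (hsymm.eigenvectorBasis finrank_euclideanSpace).reindex
    (finCongr (Fintype.card_fin d)) with hB
  have hinner : ∀ (x : EuclideanSpace ℝ (Fin d)) (u : Fin d → ℝ),
      inner ℝ x (WithLp.toLp 2 u) = x.ofLp ⬝ᵥ u := fun x u => by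
    rw [EuclideanSpace.inner_eq_star_dotProduct, dotProduct_comm]; simp
  have heig : ∀ j, M *ᵥ (B j).ofLp = eig hM j • (B j).ofLp := fun j => by
    have h := hsymm.apply_eigenvectorBasis finrank_euclideanSpace
      (Fin.cast (Fintype.card_fin d).symm j)
    have h2 := congrArg WithLp.ofLp h
    simp only [hB, OrthonormalBasis.reindex_apply]
    exact h2
  have hMt : Mᵀ = M := by simpa [Matrix.IsHermitian] using hM
  refine ⟨fun j => (B j).ofLp, heig, fun i j => ?_, fun u => ?_, fun u => ?_⟩
  · have := (orthonormal_iff_ite.1 B.orthonormal) i j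
    rw [← hinner]; exact this
  · have := B.sum_sq_norm_inner_right (WithLp.toLp 2 u)
    simp only [hinner, Real.norm_eq_abs, sq_abs] at this
    rw [this, EuclideanSpace.real_norm_sq_eq]; simp [dotProduct, sq]
  · have := B.sum_inner_mul_inner (WithLp.toLp 2 u) (WithLp.toLp 2 (M *ᵥ u))
    simp only [hinner] at this
    rw [← this]
    refine Finset.sum_congr rfl fun j _ => ?_
    have h1 : (B j).ofLp ⬝ᵥ (M *ᵥ u) = eig hM j * ((B j).ofLp ⬝ᵥ u) := by
      rw [Matrix.dotProduct_mulVec, ← Matrix.mulVec_transpose, hMt, heig, smul_dotProduct,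
        smul_eq_mul]
    change _ * ((B j).ofLp ⬝ᵥ u) ^ 2 = _
    rw [h1, dotProduct_comm u]; ring

theorem eig_antitone {M : Matrix (Fin d) (Fin d) ℝ} (hM : M.IsHermitian) : Antitone (eig hM) :=
  fun _ _ h => hM.eigenvalues₀_antitone h

/-- Monotonicity of the ordered eigenvalues in the Loewner order, up to a factor. -/
theorem mul_eig_le_eig {M N : Matrix (Fin d) (Fin d) ℝ} (hM : M.IsHermitian)
    (hN : N.IsHermitian) {c : ℝ} (hc : 0 ≤ c)
    (h : ∀ u, c * (u ⬝ᵥ (M *ᵥ u)) ≤ u ⬝ᵥ (N *ᵥ u)) (i : Fin d) :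
    c * eig hM i ≤ eig hN i := by
  obtain ⟨a, -, -, ha1, haM⟩ := exists_eigenbasis hM
  obtain ⟨b, -, -, hb1, hbN⟩ := exists_eigenbasis hN
  -- Courant–Fischer by counting: `d - 1` linear conditions leave a nonzero `u` orthogonal to `a j`
  -- for `j > i` and to `b j` for `j < i`. Its Rayleigh quotient is at least the `i`-th eigenvalue
  -- for `M` and at most the `i`-th for `N`.
  let w : Fin d → Fin d → ℝ := fun j => if i < j then a j else b j
  let W : Matrix {j : Fin d // j ≠ i} (Fin d) ℝ := Matrix.of fun j => w j
  have hker : LinearMap.ker W.mulVecLin ≠ ⊥ := LinearMap.ker_ne_bot_of_finrank_lt (by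
    simp only [Module.finrank_fintype_fun_eq_card, Fintype.card_fin]
    have := Fintype.card_subtype_lt (p := fun j : Fin d => j ≠ i) (x := i) (by simp)
    simpa using this)
  obtain ⟨u, hu, hu0⟩ := Submodule.exists_mem_ne_zero_of_ne_bot hker
  have hw : ∀ j, j ≠ i → w j ⬝ᵥ u = 0 := fun j hj => congrFun hu ⟨j, hj⟩
  have ha0 : ∀ j, i < j → a j ⬝ᵥ u = 0 := fun j hj => by
    simpa [w, hj] using hw j hj.ne'
  have hb0 : ∀ j, j < i → b j ⬝ᵥ u = 0 := fun j hj => by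
    simpa [w, hj.not_gt] using hw j hj.ne
  have hpos : 0 < u ⬝ᵥ u :=
    lt_of_le_of_ne (dotProduct_self_nonneg' u) (by simpa [eq_comm] using hu0)
  have h1 : eig hM i * (u ⬝ᵥ u) ≤ u ⬝ᵥ (M *ᵥ u) := by
    rw [← ha1, ← haM, Finset.mul_sum]
    refine Finset.sum_le_sum fun j _ => ?_
    rcases lt_or_ge i j with hj | hj
    · simp [ha0 j hj]
    · exact mul_le_mul_of_nonneg_right (eig_antitone hM hj) (sq_nonneg _)
  have h2 : u ⬝ᵥ (N *ᵥ u) ≤ eig hN i * (u ⬝ᵥ u) := by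
    rw [← hb1, ← hbN, Finset.mul_sum]
    refine Finset.sum_le_sum fun j _ => ?_
    rcases lt_or_ge j i with hj | hj
    · simp [hb0 j hj]
    · exact mul_le_mul_of_nonneg_right (eig_antitone hN hj) (sq_nonneg _)
  have h3 := mul_le_mul_of_nonneg_left h1 hc
  have h4 := h u
  exact le_of_mul_le_mul_right (by linarith) hpos

theorem eigMin_le_eig {M : Matrix (Fin d) (Fin d) ℝ} (hM : M.IsHermitian) (i : Fin d) :
    eigMin hM ≤ eig hM i := ciInf_le (Set.finite_range _).bddBelow i

theorem eigMin_mul_le {M : Matrix (Fin d) (Fin d) ℝ} (hM : M.IsHermitian) (u : Fin d → ℝ) :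
    eigMin hM * (u ⬝ᵥ u) ≤ u ⬝ᵥ (M *ᵥ u) := by
  obtain ⟨b, -, -, h1, h2⟩ := exists_eigenbasis hM
  rw [← h1, ← h2, Finset.mul_sum]
  exact Finset.sum_le_sum fun j _ =>
    mul_le_mul_of_nonneg_right (eigMin_le_eig hM j) (sq_nonneg _)

theorem le_eig_of_le_form {M : Matrix (Fin d) (Fin d) ℝ} (hM : M.IsHermitian) {c : ℝ}
    (h : ∀ u, c * (u ⬝ᵥ u) ≤ u ⬝ᵥ (M *ᵥ u)) (i : Fin d) : c ≤ eig hM i := by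
  obtain ⟨b, h1, h2, -, -⟩ := exists_eigenbasis hM
  have := h (b i)
  rw [h1 i, dotProduct_smul, h2 i i] at this
  simpa using this

theorem le_eigMin_of_le_form (hd : 0 < d) {M : Matrix (Fin d) (Fin d) ℝ} (hM : M.IsHermitian)
    {c : ℝ} (h : ∀ u, c * (u ⬝ᵥ u) ≤ u ⬝ᵥ (M *ᵥ u)) : c ≤ eigMin hM :=
  have : Nonempty (Fin d) := ⟨⟨0, hd⟩⟩
  le_ciInf fun i => le_eig_of_le_form hM h i

/-- A matrix that turns a positive definite quadratic form into the standard one. -/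
theorem exists_whitening {M : Matrix (Fin d) (Fin d) ℝ} (hM : M.IsHermitian)
    (hpos : ∀ i, 0 < eig hM i) :
    ∃ W : Matrix (Fin d) (Fin d) ℝ, (∀ y, (W *ᵥ y) ⬝ᵥ (M *ᵥ (W *ᵥ y)) = y ⬝ᵥ y) ∧
      ∀ u, ∃ y, W *ᵥ y = u := by
  obtain ⟨b, -, hb, h1, h2⟩ := exists_eigenbasis hM
  let W : Matrix (Fin d) (Fin d) ℝ := Matrix.of fun r j => b j r / √(eig hM j)
  have hW : ∀ y, W *ᵥ y = ∑ j, (y j / √(eig hM j)) • b j := fun y => by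
    funext r
    simp only [Matrix.mulVec, dotProduct, W, Matrix.of_apply, Finset.sum_apply, Pi.smul_apply,
      smul_eq_mul]
    exact Finset.sum_congr rfl fun j _ => by ring
  have hbW : ∀ k y, b k ⬝ᵥ (W *ᵥ y) = y k / √(eig hM k) := fun k y => by
    rw [hW, dotProduct_sum]; simp [dotProduct_smul, hb]
  refine ⟨W, fun y => ?_, fun u => ⟨fun j => √(eig hM j) * (b j ⬝ᵥ u), ?_⟩⟩
  · rw [← h2]
    refine Finset.sum_congr rfl fun j _ => ?_
    rw [hbW, div_pow, Real.sq_sqrt (hpos j).le, mul_div_cancel₀ _ (hpos j).ne', sq]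
  · have h3 : ∀ k, b k ⬝ᵥ (W *ᵥ (fun j => √(eig hM j) * (b j ⬝ᵥ u)) - u) = 0 := fun k => by
      rw [dotProduct_sub, hbW, mul_div_cancel_left₀ _ (Real.sqrt_pos.2 (hpos k)).ne', sub_self]
    have h4 := h1 (W *ᵥ (fun j => √(eig hM j) * (b j ⬝ᵥ u)) - u)
    simp only [h3] at h4
    rw [← sub_eq_zero, ← dotProduct_self_eq_zero, ← h4]; simp

/-- A `1/2`-separated subset of the unit ball of maximal cardinality is a net. Doubled, it is
`1`-separated in the ball of radius `2`, where the Besicovitch volume bound gives `5 ^ dim`. -/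
theorem exists_half_net (E : Type*) [NormedAddCommGroup E] [NormedSpace ℝ E]
    [FiniteDimensional ℝ E] :
    ∃ N : Finset E, N.card ≤ 5 ^ Module.finrank ℝ E ∧
      ∀ x : E, ‖x‖ ≤ 1 → ∃ y ∈ N, ‖x - y‖ ≤ 1 / 2 := by
  classical
  let P : Finset E → Prop := fun s => (∀ c ∈ s, ‖c‖ ≤ 1) ∧
    ∀ c ∈ s, ∀ c' ∈ s, c ≠ c' → 1 / 2 ≤ ‖c - c'‖
  have hcard : ∀ s, P s → s.card ≤ 5 ^ Module.finrank ℝ E := by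
    intro s hs
    have hinj : Function.Injective fun c : E => (2 : ℝ) • c := smul_right_injective E two_ne_zero
    rw [← Finset.card_image_of_injective s hinj]
    refine Besicovitch.card_le_of_separated _ ?_ ?_
    · simp only [Finset.mem_image, forall_exists_index, and_imp, forall_apply_eq_imp_iff₂]
      intro c hc
      rw [norm_smul]; have := hs.1 c hc; simp; linarith
    · simp only [Finset.mem_image, forall_exists_index, and_imp, forall_apply_eq_imp_iff₂]
      intro c hc c' hc' hne
      have := hs.2 c hc c' hc' fun h => hne (by rw [h])
      rw [← smul_sub, norm_smul]; simp; linarith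
  have hex : ∃ s, P s ∧ ∀ s', P s' → s'.card ≤ s.card := by
    have hne : {k | ∃ s, P s ∧ s.card = k}.Nonempty := ⟨0, ∅, ⟨by simp, by simp⟩, rfl⟩
    have hbdd : BddAbove {k | ∃ s, P s ∧ s.card = k} :=
      ⟨5 ^ Module.finrank ℝ E, by rintro k ⟨s, hs, rfl⟩; exact hcard s hs⟩
    obtain ⟨s, hs, hk⟩ := Nat.sSup_mem hne hbdd
    exact ⟨s, hs, fun s' hs' => hk ▸ le_csSup hbdd ⟨s', hs', rfl⟩⟩
  obtain ⟨s, hs, hmax⟩ := hex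
  refine ⟨s, hcard s hs, fun x hx => ?_⟩
  by_contra! hcon
  have hxs : x ∉ s := fun h => by have := hcon x h; simp at this; linarith
  have hP : P (insert x s) := by
    refine ⟨fun c hc => ?_, fun c hc c' hc' hne => ?_⟩
    · rcases Finset.mem_insert.1 hc with rfl | h
      exacts [hx, hs.1 c h]
    · rcases Finset.mem_insert.1 hc with rfl | h <;> rcases Finset.mem_insert.1 hc' with rfl | h'
      · exact absurd rfl hne
      · exact (hcon c' h').le
      · rw [norm_sub_rev]; exact (hcon c h).le
      · exact hs.2 c h c' h' hne
  have := hmax _ hP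
  rw [Finset.card_insert_of_notMem hxs] at this
  omega

/-- The half-net is used twice, for `x` and then for the doubled residual, whence `5^d * 5^d`
points. The origin is too far from the sphere to be needed, and discarding it leaves genuine
directions. -/
theorem exists_quarter_net (d : ℕ) :
    ∃ N : Finset (Fin d → ℝ), N.card ≤ 25 ^ d ∧ 0 ∉ N ∧
      ∀ x : Fin d → ℝ, x ⬝ᵥ x = 1 → ∃ y ∈ N, (x - y) ⬝ᵥ (x - y) ≤ 1 / 16 := by
  classical
  obtain ⟨N, hN, hcov⟩ := exists_half_net (EuclideanSpace ℝ (Fin d))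
  rw [finrank_euclideanSpace_fin] at hN
  refine ⟨(Finset.image₂ (fun y z => (y + (1 / 2 : ℝ) • z).ofLp) N N).erase 0, ?_, by simp,
    fun x hx => ?_⟩
  · refine (Finset.card_erase_le).trans ((Finset.card_image₂_le _ _ _).trans ?_)
    calc N.card * N.card ≤ 5 ^ d * 5 ^ d := Nat.mul_le_mul hN hN
      _ = 25 ^ d := by rw [← mul_pow]; norm_num
  · have hnorm : ∀ u : EuclideanSpace ℝ (Fin d), u.ofLp ⬝ᵥ u.ofLp = ‖u‖ ^ 2 := fun u => by
      rw [EuclideanSpace.real_norm_sq_eq]; simp [dotProduct, sq]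
    have hx1 : ‖WithLp.toLp 2 x‖ = 1 := by
      have := hnorm (WithLp.toLp 2 x)
      rw [hx] at this
      have h0 := norm_nonneg (WithLp.toLp 2 x)
      nlinarith
    obtain ⟨y, hy, hxy⟩ := hcov _ hx1.le
    obtain ⟨z, hz, hxz⟩ := hcov ((2 : ℝ) • (WithLp.toLp 2 x - y)) (by
      rw [norm_smul]; simp; linarith)
    have hdist : (x - (y + (1 / 2 : ℝ) • z).ofLp) ⬝ᵥ (x - (y + (1 / 2 : ℝ) • z).ofLp)
        ≤ 1 / 16 := by
      have h1 : WithLp.toLp 2 x - (y + (1 / 2 : ℝ) • z)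
          = (1 / 2 : ℝ) • ((2 : ℝ) • (WithLp.toLp 2 x - y) - z) := by
        rw [smul_sub, smul_smul]; norm_num; abel
      have h2 : ‖WithLp.toLp 2 x - (y + (1 / 2 : ℝ) • z)‖ ≤ 1 / 4 := by
        rw [h1, norm_smul]; norm_num; linarith
      have h3 := hnorm (WithLp.toLp 2 x - (y + (1 / 2 : ℝ) • z))
      rw [WithLp.ofLp_sub] at h3
      refine h3.le.trans ?_
      nlinarith [norm_nonneg (WithLp.toLp 2 x - (y + (1 / 2 : ℝ) • z))]
    refine ⟨_, Finset.mem_erase.2 ⟨fun h0 => ?_, Finset.mem_image₂_of_mem hy hz⟩, hdist⟩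
    rw [h0, sub_zero, hx] at hdist
    norm_num at hdist

theorem sq_dotProduct_le (x y : Fin d → ℝ) : (x ⬝ᵥ y) ^ 2 ≤ (x ⬝ᵥ x) * (y ⬝ᵥ y) := by
  simpa [dotProduct, sq] using Finset.sum_mul_sq_le_sq_mul_sq Finset.univ x y

/-- A quadratic form that is small on a `1/4`-net of the sphere is small everywhere. -/
theorem abs_form_le_of_net {M : Matrix (Fin d) (Fin d) ℝ} (hM : M.IsHermitian)
    {N : Finset (Fin d → ℝ)}
    (hcov : ∀ x : Fin d → ℝ, x ⬝ᵥ x = 1 → ∃ y ∈ N, (x - y) ⬝ᵥ (x - y) ≤ 1 / 16)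
    (hN : ∀ y ∈ N, |y ⬝ᵥ (M *ᵥ y)| ≤ 1 / 8 * (y ⬝ᵥ y)) (x : Fin d → ℝ) :
    |x ⬝ᵥ (M *ᵥ x)| ≤ 1 / 2 * (x ⬝ᵥ x) := by
  rcases Nat.eq_zero_or_pos d with rfl | hd
  · simp [dotProduct]
  have : Nonempty (Fin d) := ⟨⟨0, hd⟩⟩
  obtain ⟨b, hb, hbb, h1, h2⟩ := exists_eigenbasis hM
  -- At an eigenvector of extremal `|λ|` the cross terms are exact: with `y = b i - z`, the form at
  -- `y` is `λ (1 - 2t)` plus the form at `z`. This gives `|λ|/2 ≤ 25/128 + |λ|/16`, hence `|λ| ≤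
  -- 25/56`.
  obtain ⟨i, hi⟩ := Finite.exists_max fun j => |eig hM j|
  have hform : ∀ z, |z ⬝ᵥ (M *ᵥ z)| ≤ |eig hM i| * (z ⬝ᵥ z) := fun z => by
    rw [← h1, ← h2, Finset.mul_sum]
    refine (Finset.abs_sum_le_sum_abs _ _).trans (Finset.sum_le_sum fun j _ => ?_)
    rw [abs_mul, abs_of_nonneg (sq_nonneg (b j ⬝ᵥ z))]
    exact mul_le_mul_of_nonneg_right (hi j) (sq_nonneg _)
  suffices h : |eig hM i| ≤ 1 / 2 from
    (hform x).trans (mul_le_mul_of_nonneg_right h (dotProduct_self_nonneg' x))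
  have hunit : b i ⬝ᵥ b i = 1 := by rw [hbb]; simp
  obtain ⟨y, hy, hxy⟩ := hcov (b i) hunit
  obtain ⟨z, hz⟩ : ∃ z, z = b i - y := ⟨_, rfl⟩
  rw [← hz] at hxy
  set t := z ⬝ᵥ b i with ht
  have hyz : y = b i - z := by rw [hz]; abel
  have ht1 : |t| ≤ 1 / 4 := by
    have := sq_dotProduct_le z (b i)
    rw [hunit, ← ht] at this
    exact abs_le_of_sq_le_sq (by linarith) (by norm_num)
  have hyy : y ⬝ᵥ y ≤ 25 / 16 := by
    have : y ⬝ᵥ y = 1 - 2 * t + z ⬝ᵥ z := by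
      rw [hyz, sub_dotProduct, dotProduct_sub, dotProduct_sub, hunit, dotProduct_comm (b i) z,
        ← ht]
      ring
    have := (abs_le.1 ht1).1
    linarith
  have hMt : Mᵀ = M := by simpa [Matrix.IsHermitian] using hM
  have hyM : y ⬝ᵥ (M *ᵥ y) = eig hM i * (1 - 2 * t) + z ⬝ᵥ (M *ᵥ z) := by
    have hbz : b i ⬝ᵥ (M *ᵥ z) = eig hM i * t := by
      rw [Matrix.dotProduct_mulVec, ← Matrix.mulVec_transpose, hMt, hb, smul_dotProduct,
        smul_eq_mul, dotProduct_comm]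
    rw [hyz, Matrix.mulVec_sub, sub_dotProduct, dotProduct_sub, dotProduct_sub, hbz, hb,
      dotProduct_smul, dotProduct_smul, hunit, smul_eq_mul, smul_eq_mul]
    ring
  have hzM : |z ⬝ᵥ (M *ᵥ z)| ≤ |eig hM i| * (1 / 16) :=
    (hform z).trans (mul_le_mul_of_nonneg_left hxy (abs_nonneg _))
  have hlow : |eig hM i| * (1 / 2) ≤ |eig hM i * (1 - 2 * t)| := by
    rw [abs_mul]
    refine mul_le_mul_of_nonneg_left ?_ (abs_nonneg _)
    refine le_trans ?_ (le_abs_self _)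
    linarith [(abs_le.1 ht1).2]
  have htri : |eig hM i * (1 - 2 * t)| ≤ |y ⬝ᵥ (M *ᵥ y)| + |z ⬝ᵥ (M *ᵥ z)| := by
    have : eig hM i * (1 - 2 * t) = y ⬝ᵥ (M *ᵥ y) - z ⬝ᵥ (M *ᵥ z) := by rw [hyM]; ring
    rw [this]; exact abs_sub _ _
  have := hN y hy
  linarith

end Spectral

/-! ### From the noise hypotheses to its law -/

section NoiseLaw

variable {Ω : Type*} [MeasurableSpace Ω] {μ : Measure Ω} {d : ℕ}
  {ξ : Ω → Fin d → ℝ} {σ : ℝ≥0}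

theorem expMoment_map (hξ : Measurable ξ) {f : (Fin d → ℝ) → ℝ} (hf : Measurable f) :
    expMoment (μ.map ξ) f = expMoment μ fun ω => f (ξ ω) :=
  lintegral_map (by fun_prop) hξ

theorem IsSubGaussianVec.hasSubgaussianMGF_apply (h : IsSubGaussianVec ξ σ μ) (i : Fin d) :
    HasSubgaussianMGF (fun ω => ξ ω i) (σ ^ 2) μ := by
  simpa using h (Pi.single i 1) (by simp)

theorem IsSubGaussianVec.integrable_mul (h : IsSubGaussianVec ξ σ μ) (i j : Fin d) :
    Integrable (fun ω => ξ ω i * ξ ω j) μ :=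
  MemLp.integrable_mul (p := 2) (q := 2) (by simpa using (h.hasSubgaussianMGF_apply i).memLp 2)
    (by simpa using (h.hasSubgaussianMGF_apply j).memLp 2)

theorem two_add_sq_le_exp_add_exp_neg (x : ℝ) : 2 + x * x ≤ Real.exp x + Real.exp (-x) := by
  have h1 := Real.cosh_eq x
  have h2 : Real.cosh x = 1 + 2 * Real.sinh (x / 2) ^ 2 := by
    have := Real.cosh_two_mul (x / 2)
    rw [Real.cosh_sq, mul_div_cancel₀ x two_ne_zero] at this
    linarith
  have h3 : (x / 2) ^ 2 ≤ Real.sinh (x / 2) ^ 2 := by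
    rw [sq_le_sq, Real.abs_sinh]
    exact Real.self_le_sinh_iff.2 (abs_nonneg _)
  nlinarith

/-- Unit variance forces a lower bound on the proxy: integrating `2 + x² ≤ exp x + exp (-x)` gives
`3 ≤ 2 exp (σ²/2)`, whereas `exp (1/4) < 3/2`. A coordinate must exist, hence `0 < d`. -/
theorem half_le_sq_of_isIsotropic [IsProbabilityMeasure μ] (hd : 0 < d) (h : IsSubGaussianVec ξ σ μ)
    (hiso : IsIsotropic ξ μ) : 1 / 2 ≤ (σ : ℝ) ^ 2 := by
  set i : Fin d := ⟨0, hd⟩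
  have hs := h.hasSubgaussianMGF_apply i
  have h1 := hs.mgf_le 1
  have h2 := hs.mgf_le (-1)
  have hvar : ∫ ω, ξ ω i * ξ ω i ∂μ = 1 := by simpa using hiso i i
  have hi1 := hs.integrable_exp_mul 1
  have hi2 := hs.integrable_exp_mul (-1)
  have hmain : ∫ ω, (2 + ξ ω i * ξ ω i) ∂μ
      ≤ ∫ ω, (Real.exp (1 * ξ ω i) + Real.exp (-1 * ξ ω i)) ∂μ := by
    refine integral_mono ((integrable_const _).add (h.integrable_mul i i)) (hi1.add hi2)
      fun ω => ?_
    simpa only [one_mul, neg_one_mul] using two_add_sq_le_exp_add_exp_neg (ξ ω i)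
  rw [integral_add (integrable_const _) (h.integrable_mul i i), integral_add hi1 hi2, hvar] at hmain
  simp only [integral_const, probReal_univ, one_smul] at hmain
  simp only [mgf] at h1 h2
  by_contra! hlt
  have hexp : Real.exp ((σ : ℝ) ^ 2 / 2) ≤ Real.exp (1 / 4) := Real.exp_le_exp.2 (by linarith)
  have h4 : Real.exp (1 / 4) < 3 / 2 := by
    have e : Real.exp (1 / 4) ^ 4 = Real.exp 1 := by rw [← Real.exp_nat_mul]; norm_num
    by_contra! hge
    have := pow_le_pow_left₀ (by norm_num) hge 4
    rw [e] at this
    have := Real.exp_one_lt_d9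
    norm_num at *
    linarith
  push_cast at h1 h2
  norm_num at h1 h2 hmain
  linarith

theorem isIsotropicSubGaussian_map [IsProbabilityMeasure μ] (hd : 0 < d) (hξ : Measurable ξ)
    (h : IsSubGaussianVec ξ σ μ) (hiso : IsIsotropic ξ μ) :
    IsIsotropicSubGaussian (μ.map ξ) ((σ : ℝ) ^ 2) := by
  have hsq : ∀ y z : Fin d → ℝ, (y ⬝ᵥ z) ^ 2 = ∑ i, ∑ j, y i * y j * (z i * z j) := by
    intro y z
    rw [sq, dotProduct, Finset.sum_mul_sum]
    exact Finset.sum_congr rfl fun i _ => Finset.sum_congr rfl fun j _ => by ring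
  have hm : ∀ y : Fin d → ℝ, Measurable fun z => (y ⬝ᵥ z) ^ 2 := fun y =>
    (measurable_dotProduct y).pow_const 2
  refine ⟨half_le_sq_of_isIsotropic hd h hiso, fun y => ?_, fun y => ?_, fun y => ?_⟩
  · rw [expMoment_map hξ (measurable_dotProduct y)]
    rcases eq_or_ne y 0 with rfl | hy
    · simp [expMoment]
    · have hN : 0 < y ⬝ᵥ y :=
        lt_of_le_of_ne (dotProduct_self_nonneg' y) (by simpa [eq_comm] using hy)
      have hu : direction y ⬝ᵥ direction y = 1 := by
        have := mul_direction_dotProduct_self y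
        exact mul_left_cancel₀ hN.ne' (by rw [this, mul_one])
      have hy' : y = √(y ⬝ᵥ y) • direction y := by
        rw [direction, smul_smul, mul_inv_cancel₀ (Real.sqrt_pos.2 hN).ne', one_smul]
      have hs := h _ hu
      have hmgf := hs.mgf_le √(y ⬝ᵥ y)
      rw [mgf, Real.sq_sqrt hN.le] at hmgf
      have hf : ∀ ω, y ⬝ᵥ ξ ω = √(y ⬝ᵥ y) * (direction y ⬝ᵥ ξ ω) := fun ω => by
        conv_lhs => rw [hy', smul_dotProduct, smul_eq_mul]
      simp only [hf, expMoment]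
      rw [← ofReal_integral_eq_lintegral_ofReal (hs.integrable_exp_mul _)
        (ae_of_all _ fun _ => (Real.exp_pos _).le)]
      exact ENNReal.ofReal_le_ofReal (by simpa using hmgf)
  · rw [integrable_map_measure (hm y).aestronglyMeasurable hξ.aemeasurable]
    simp only [Function.comp_def, hsq]
    exact integrable_finsetSum _ fun i _ => integrable_finsetSum _ fun j _ =>
      (h.integrable_mul i j).const_mul _
  · rw [integral_map hξ.aemeasurable (hm y).aestronglyMeasurable]
    simp only [hsq]
    rw [integral_finsetSum _ fun i _ => integrable_finsetSum _ fun j _ =>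
      (h.integrable_mul i j).const_mul _]
    refine Finset.sum_congr rfl fun i _ => ?_
    rw [integral_finsetSum _ fun j _ => (h.integrable_mul i j).const_mul _]
    simp only [integral_const_mul, hiso i, Matrix.one_apply]
    simp

end NoiseLaw

/-! ### Uniformity over directions -/

section Uniform

variable {Ω : Type*} [MeasurableSpace Ω] {μ : Measure Ω} [IsProbabilityMeasure μ] {d : ℕ}
  {ν : Measure (Fin d → ℝ)} {V p : ℝ} {A : Matrix (Fin d) (Fin d) ℝ}
  {η x : ℕ → Ω → Fin d → ℝ}

/-- Outside an event of small probability, the empirical covariance matrix approximates the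
averaged Gramian in the Loewner order. -/
theorem exists_bad_event (hA : HasOrbitBound A p) (hν : IsIsotropicSubGaussian ν V)
    (hη : ∀ t, Measurable (η t)) (hind : iIndepFun η μ) (hlaw : ∀ t, μ.map (η t) = ν)
    (hx0 : ∀ ω, x 0 ω = 0) (hx : ∀ t ω, x (t + 1) ω = A *ᵥ x t ω + η t ω) {n : ℕ}
    (hn : 1 ≤ n) :
    ∃ E : Set Ω, μ E ≤ ENNReal.ofReal (25 ^ d * (2 * Real.exp
        (-(n * eigMin (avgCov_isHermitian A n) / (2097152 * V ^ 2 * p ^ 3))))) ∧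
      ∀ ω ∉ E, ∀ u, |u ⬝ᵥ (empCov (fun t => x t ω) n *ᵥ u) - u ⬝ᵥ (avgCov A n *ᵥ u)|
        ≤ 1 / 2 * (u ⬝ᵥ (avgCov A n *ᵥ u)) := by
  have hp0 : 0 < p := by linarith [hA.one_le]
  have hV0 : 0 < V := by linarith [hν.half_le]
  have hn0 : (0 : ℝ) < n := by exact_mod_cast hn
  set lam := eigMin (avgCov_isHermitian A n) with hlam
  have hpos : ∀ i, 0 < eig (avgCov_isHermitian A n) i := fun i =>
    lt_of_lt_of_le one_pos (le_eig_of_le_form _ (fun u => by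
      rw [one_mul]; exact dotProduct_self_le_avgCov A u hn) i)
  obtain ⟨W, hW, hsurj⟩ := exists_whitening _ hpos
  obtain ⟨N, hcard, h0N, hcov⟩ := exists_quarter_net d
  let S : (Fin d → ℝ) → ℝ := fun u => ∑ s ∈ Finset.range n, orbitSum A u (s + 1)
  have hS : ∀ u, u ⬝ᵥ (avgCov A n *ᵥ u) = (n : ℝ)⁻¹ * S u := fun u => dotProduct_avgCov A u n
  let B : (Fin d → ℝ) → Set Ω := fun u =>
    {ω | S u / 8 < |∑ s ∈ Finset.range n, (u ⬝ᵥ x (s + 1) ω) ^ 2 - S u|}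
  -- In the coordinates `u = W *ᵥ y` the form of `Σ` is `y ⬝ᵥ y`, so a relative error in every
  -- direction is an absolute one on the sphere, and the net is transported by `W`.
  refine ⟨⋃ y ∈ N, B (W *ᵥ y), ?_, fun ω hω u => ?_⟩
  · calc μ (⋃ y ∈ N, B (W *ᵥ y)) ≤ ∑ y ∈ N, μ (B (W *ᵥ y)) := measure_biUnion_finset_le _ _
      _ ≤ ∑ y ∈ N, ENNReal.ofReal (2 * Real.exp (-(n * lam / (2097152 * V ^ 2 * p ^ 3)))) := by
          refine Finset.sum_le_sum fun y hy => ?_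
          have hy0 : y ≠ 0 := fun h => h0N (h ▸ hy)
          set u := W *ᵥ y with hu
          have hyy : 0 < y ⬝ᵥ y :=
            lt_of_le_of_ne (dotProduct_self_nonneg' y) (by simpa [eq_comm] using hy0)
          have hu0 : u ≠ 0 := fun h => by
            have := hW y
            rw [← hu, h, zero_dotProduct] at this
            exact hyy.ne this
          have huu : 0 < u ⬝ᵥ u :=
            lt_of_le_of_ne (dotProduct_self_nonneg' u) (by simpa [eq_comm] using hu0)
          refine (measure_path_deviation_le hA hν hη hind hlaw hx0 hx hu0 n (S := S u) rfl).trans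
            (ENNReal.ofReal_le_ofReal ?_)
          gcongr 2 * Real.exp (-?_)
          have h1 := eigMin_mul_le (avgCov_isHermitian A n) u
          rw [hS, ← hlam] at h1
          have h2 : n * lam * (u ⬝ᵥ u) ≤ S u := by
            have := mul_le_mul_of_nonneg_left h1 hn0.le
            rwa [mul_inv_cancel_left₀ hn0.ne', ← mul_assoc] at this
          rw [← div_div _ _ (u ⬝ᵥ u), div_right_comm]
          refine div_le_div_of_nonneg_right ?_ (by positivity)
          rwa [le_div_iff₀ huu]
      _ ≤ _ := by
          rw [Finset.sum_const, nsmul_eq_mul,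
            ENNReal.ofReal_mul (p := 25 ^ d) (by positivity),
            ← ENNReal.ofReal_natCast]
          have hcard' : (N.card : ℝ) ≤ 25 ^ d := by exact_mod_cast hcard
          exact mul_le_mul_left (ENNReal.ofReal_le_ofReal hcard') _
  · set D := empCov (fun t => x t ω) n - avgCov A n with hD
    have hDh : D.IsHermitian := (empCov_isHermitian _ n).sub (avgCov_isHermitian A n)
    have hform : ∀ y, y ⬝ᵥ ((Wᵀ * D * W) *ᵥ y)
        = (W *ᵥ y) ⬝ᵥ (empCov (fun t => x t ω) n *ᵥ (W *ᵥ y))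
        - (W *ᵥ y) ⬝ᵥ (avgCov A n *ᵥ (W *ᵥ y)) := fun y => by
      rw [← Matrix.mulVec_mulVec, ← Matrix.mulVec_mulVec, Matrix.dotProduct_mulVec,
        ← Matrix.mulVec_transpose, Matrix.transpose_transpose, hD, Matrix.sub_mulVec,
        dotProduct_sub]
    have hWD : (Wᵀ * D * W).IsHermitian := by
      have := Matrix.isHermitian_conjTranspose_mul_mul W hDh
      simpa using this
    obtain ⟨y, rfl⟩ := hsurj u
    rw [← hform, hW]
    refine abs_form_le_of_net hWD hcov (fun z hz => ?_) y
    rw [hform, ← hW z, hS, dotProduct_empCov, ← mul_sub, abs_mul, abs_of_pos (by positivity)]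
    have hz' : ω ∉ B (W *ᵥ z) := fun h => hω (Set.mem_biUnion hz h)
    simp only [B, Set.mem_ofPred_eq, not_lt] at hz'
    calc _ ≤ (n : ℝ)⁻¹ * (S (W *ᵥ z) / 8) := by gcongr
      _ = _ := by ring

/-- Subadditivity in place of complementation, so that neither event has to be measurable. -/
theorem one_sub_le_measureReal_of_compl {E G : Set Ω} {δ : ℝ} (hδ : 0 ≤ δ)
    (hE : μ E ≤ ENNReal.ofReal δ) (hG : ∀ ω ∉ E, ω ∈ G) : 1 - δ ≤ μ.real G := by
  have h1 : μ.real E ≤ δ := ENNReal.toReal_le_of_le_ofReal hδ hE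
  have h2 : μ.real Set.univ ≤ μ.real (G ∪ E) :=
    measureReal_mono fun ω _ => by by_cases h : ω ∈ E; exacts [Or.inr h, Or.inl (hG ω h)]
  have h3 := measureReal_union_le (μ := μ) G E
  rw [probReal_univ] at h2
  linarith

/-- The source of the dimensional constant `5`: `2 * 25^d ≤ 50^d ≤ exp (5d)` for `d ≥ 1`. -/
theorem covering_prob_le {δ K : ℝ} (hd : 0 < d) (hδ : 0 < δ)
    (hK : Real.log (1 / δ) + 5 * d ≤ K) : 25 ^ d * (2 * Real.exp (-K)) ≤ δ := by
  have h1 : Real.exp (-K) ≤ δ * (Real.exp 5 ^ d)⁻¹ := by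
    calc Real.exp (-K) ≤ Real.exp (Real.log δ + -(d * 5)) := by
          refine Real.exp_le_exp.2 ?_
          rw [one_div, Real.log_inv] at hK; linarith
      _ = _ := by rw [Real.exp_add, Real.exp_log hδ, Real.exp_neg, Real.exp_nat_mul]
  have h5 : (50 : ℝ) ≤ Real.exp 5 := by
    have e : Real.exp 1 ^ 5 = Real.exp 5 := by rw [← Real.exp_nat_mul]; norm_num
    have := pow_le_pow_left₀ (by norm_num) Real.exp_one_gt_d9.le 5
    rw [e] at this
    refine le_trans ?_ this
    norm_num
  have h2 : (25 : ℝ) ^ d * 2 ≤ Real.exp 5 ^ d := by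
    calc (25 : ℝ) ^ d * 2 ≤ 25 ^ d * 2 ^ d := by gcongr; exact le_self_pow₀ (by norm_num) hd.ne'
      _ = 50 ^ d := by rw [← mul_pow]; norm_num
      _ ≤ _ := by gcongr
  have h3 : 0 < Real.exp 5 ^ d := by positivity
  calc 25 ^ d * (2 * Real.exp (-K)) ≤ 25 ^ d * (2 * (δ * (Real.exp 5 ^ d)⁻¹)) := by gcongr
    _ = (25 ^ d * 2) / Real.exp 5 ^ d * δ := by ring
    _ ≤ 1 * δ := by gcongr; rwa [div_le_one h3]
    _ = δ := one_mul δ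

end Uniform

end LDS

/-! ### The main theorem -/

open LDS in
theorem mainTheorem11 :
    ∃ c₁ c₂ c₃ c₄ : ℝ, 0 < c₁ ∧ 0 < c₂ ∧ 0 < c₃ ∧ 0 < c₄ ∧
      ∀ {Ω : Type*} [MeasurableSpace Ω] (μ : Measure Ω) [IsProbabilityMeasure μ]
        (d : ℕ) (A : Matrix (Fin d) (Fin d) ℝ) (σ : ℝ≥0)
        (η x : ℕ → Ω → Fin d → ℝ) (n : ℕ) (δ : ℝ),
        LDS.IsStable A →
        (∀ t, Measurable (η t)) →
        iIndepFun η μ →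
        (∀ t, IdentDistrib (η t) (η 0) μ μ) →
        (∀ t j, ∫ ω, η t ω j ∂μ = 0) →
        (∀ t, LDS.IsIsotropic (η t) μ) →
        (∀ t, LDS.IsSubGaussianVec (η t) σ μ) →
        (∀ ω, x 0 ω = 0) →
        (∀ t ω, x (t + 1) ω = A *ᵥ x t ω + η t ω) →
        1 ≤ n →
        0 < δ →
        ((n : ℝ) ≥ c₁ * (σ : ℝ) ^ 4 * LDS.opNorm (LDS.gramianInf A) ^ 3
              / LDS.eigMin (LDS.avgCov_isHermitian A n) * (Real.log (1 / δ) + c₂ * d) →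
          1 - δ ≤ μ.real {ω | ∀ i : Fin d,
            1 / 2 * LDS.eig (LDS.avgCov_isHermitian A n) i
                ≤ LDS.eig (LDS.empCov_isHermitian (fun t => x t ω) n) i ∧
            LDS.eig (LDS.empCov_isHermitian (fun t => x t ω) n) i
                ≤ 3 / 2 * LDS.eig (LDS.avgCov_isHermitian A n) i}) ∧
        ((n : ℝ) ≥ c₃ * (σ : ℝ) ^ 4 * LDS.opNorm (LDS.gramianInf A) ^ 3
              / LDS.eigMin (LDS.gramianInf_isHermitian A) * (Real.log (1 / δ) + c₄ * d) →
          1 - δ ≤ μ.real {ω | ∀ i : Fin d,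
            1 / 8 * LDS.eig (LDS.gramianInf_isHermitian A) i
                ≤ LDS.eig (LDS.empCov_isHermitian (fun t => x t ω) n) i ∧
            LDS.eig (LDS.empCov_isHermitian (fun t => x t ω) n) i
                ≤ 3 / 2 * LDS.eig (LDS.gramianInf_isHermitian A) i}) := by
  -- `2097152 = 16 * 131072` is the constant of the tail bound. It doubles in (b), where `λ_min(Σ)`
  -- is only known to be at least `λ_min(Γ_∞)/2`.
  refine ⟨2097152, 5, 4194304, 5, by norm_num, by norm_num, by norm_num, by norm_num, ?_⟩
  intro Ω _ μ _ d A σ η x n δ hstab hη hind hid _ hiso hsub hx0 hx hn hδ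
  rcases Nat.eq_zero_or_pos d with rfl | hd
  · have huniv : ∀ G : Set Ω, (∀ ω, ω ∈ G) → 1 - δ ≤ μ.real G := fun G hG =>
      one_sub_le_measureReal_of_compl (E := ∅) hδ.le (by simp) fun ω _ => hG ω
    exact ⟨fun _ => huniv _ fun ω i => i.elim0, fun _ => huniv _ fun ω i => i.elim0⟩
  -- For `δ > 1` the claim is void; otherwise `log (1/δ) ≥ 0`, which the comparisons of sample sizes
  -- in (b) use.
  rcases lt_or_ge 1 δ with hδ1 | hδ1
  · exact ⟨fun _ => (by linarith : 1 - δ ≤ 0).trans measureReal_nonneg,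
      fun _ => (by linarith : 1 - δ ≤ 0).trans measureReal_nonneg⟩
  have hν := isIsotropicSubGaussian_map hd (hη 0) (hsub 0) (hiso 0)
  have hA := hstab.hasOrbitBound hd
  have hlaw : ∀ t, μ.map (η t) = μ.map (η 0) := fun t => (hid t).map_eq
  obtain ⟨E, hE, hgood⟩ := exists_bad_event hA hν hη hind hlaw hx0 hx hn
  set p := opNorm (gramianInf A) with hp
  have hp1 : 1 ≤ p := hA.one_le
  have hp0 : 0 < p := by linarith
  have hV : 1 / 2 ≤ (σ : ℝ) ^ 2 := hν.half_le
  have hσ4 : ((σ : ℝ) ^ 2) ^ 2 = (σ : ℝ) ^ 4 := by ring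
  have hσ : 1 / 4 ≤ (σ : ℝ) ^ 4 := by rw [← hσ4]; nlinarith
  have hσ0 : 0 < (σ : ℝ) ^ 4 := by linarith
  have hlog : 0 ≤ Real.log (1 / δ) := Real.log_nonneg (by rw [le_div_iff₀ hδ]; linarith)
  have hd1 : (1 : ℝ) ≤ d := by exact_mod_cast hd
  rw [hσ4] at hE
  set lam := eigMin (avgCov_isHermitian A n) with hlam
  have hlam1 : 1 ≤ lam := le_eigMin_of_le_form hd _ fun u => by
    rw [one_mul]; exact dotProduct_self_le_avgCov A u hn
  have hlam0 : 0 < lam := by linarith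
  have hEδ : 2097152 * (σ : ℝ) ^ 4 * p ^ 3 / lam * (Real.log (1 / δ) + 5 * d) ≤ n →
      μ E ≤ ENNReal.ofReal δ := fun h => by
    refine hE.trans (ENNReal.ofReal_le_ofReal (covering_prob_le hd hδ ?_))
    rw [le_div_iff₀ (by positivity)]
    rw [div_mul_eq_mul_div, div_le_iff₀ hlam0] at h
    linarith
  have hlow : ∀ ω ∉ E, ∀ u, 1 / 2 * (u ⬝ᵥ (avgCov A n *ᵥ u))
      ≤ u ⬝ᵥ (empCov (fun t => x t ω) n *ᵥ u) := fun ω hω u => by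
    linarith [(abs_le.1 (hgood ω hω u)).1]
  have hupp : ∀ ω ∉ E, ∀ u, u ⬝ᵥ (empCov (fun t => x t ω) n *ᵥ u)
      ≤ 3 / 2 * (u ⬝ᵥ (avgCov A n *ᵥ u)) := fun ω hω u => by
    linarith [(abs_le.1 (hgood ω hω u)).2]
  refine ⟨fun h => one_sub_le_measureReal_of_compl hδ.le (hEδ h) fun ω hω i => ⟨?_, ?_⟩,
    fun h => ?_⟩
  · exact mul_eig_le_eig _ _ (by norm_num) (hlow ω hω) i
  -- The upper bound is the same comparison with the matrices exchanged and factor `2/3`.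
  · have := mul_eig_le_eig (empCov_isHermitian (fun t => x t ω) n) (avgCov_isHermitian A n)
      (c := 2 / 3) (by norm_num) (fun u => by linarith [hupp ω hω u]) i
    linarith
  · set lamI := eigMin (gramianInf_isHermitian A) with hlamI
    have hlamI1 : 1 ≤ lamI := le_eigMin_of_le_form hd _ fun u => by
      rw [one_mul]; exact hstab.dotProduct_self_le_gramForm u
    have hlamI0 : 0 < lamI := by linarith
    have hlamIp : lamI ≤ p := by
      let u : Fin d → ℝ := Pi.single ⟨0, hd⟩ 1
      have hu : u ⬝ᵥ u = 1 := by simp [u]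
      have h1 := eigMin_mul_le (gramianInf_isHermitian A) u
      have h2 := dotProduct_mulVec_le_opNorm (gramianInf A) u
      rw [hu] at h1 h2
      linarith
    -- The sample size in (b) already exceeds the mixing time, because `λ_min(Γ_∞) ≤ p`, `σ⁴ ≥ 1/4`
    -- and `p³/p ≥ p`.
    have hn2 : 2 * p ≤ n := by
      refine le_trans ?_ h
      calc 2 * p ≤ 4194304 * (1 / 4) * p ^ 3 / p * (0 + 5 * 1) := by
            field_simp; nlinarith
        _ ≤ _ := by gcongr
    have hhalf := fun u => hstab.half_gramForm_le_avgCov hd u hn2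
    have hlam2 : lamI / 2 ≤ lam := le_eigMin_of_le_form hd _ fun u => by
      have h1 := eigMin_mul_le (gramianInf_isHermitian A) u
      have h2 := hhalf u
      unfold gramForm at h2
      rw [← hlamI] at h1
      linarith
    have hna : 2097152 * (σ : ℝ) ^ 4 * p ^ 3 / lam * (Real.log (1 / δ) + 5 * d) ≤ n := by
      refine le_trans ?_ h
      calc _ ≤ 2097152 * (σ : ℝ) ^ 4 * p ^ 3 / (lamI / 2) * (Real.log (1 / δ) + 5 * d) := by
            gcongr
        _ = _ := by field_simp; ring
    refine one_sub_le_measureReal_of_compl hδ.le (hEδ hna) fun ω hω i => ⟨?_, ?_⟩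
    · refine mul_eig_le_eig _ _ (by norm_num) (fun u => ?_) i
      have h1 := hlow ω hω u
      have h2 := hhalf u
      have h3 := (dotProduct_self_nonneg' u).trans (hstab.dotProduct_self_le_gramForm u)
      unfold gramForm at h2 h3
      linarith
    · have := mul_eig_le_eig (empCov_isHermitian (fun t => x t ω) n) (gramianInf_isHermitian A)
        (c := 2 / 3) (by norm_num) (fun u => by
          have h1 := hupp ω hω u
          have h2 := hstab.avgCov_le_gramForm u hn
          unfold gramForm at h2
          linarith) i
      linarith
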